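/- Let $\mathbb R_+=(0,\infty)$ and let $a,a_1,r$ be real functions on $\mathbb R_+$ such that * $0\le a\in L_{\infty,loc}([0,\infty))$; * $1/r\in L_{1,loc}(\mathbb R_+)$ and $0<r(x)\le r_0+r_1x$ on $\mathbb R_+$ for some constants $r_0,r_1\ge 0$; put $\tilde r=\max\{r_0,r_1\}$; * $0\le a_1\in L_{\infty,loc}([0,\infty))$, and $a_1/a$ remains bounded as $x\to\infty$, i.e. there are $C,N$ with $a_1(x)\le C\,a(x)$ for $x\ge N$. Put $q=a+a_1$ and, for real $m\ge 1$, let $X_{0,m}=L_1(\mathbb R_+,(1+x^m)\,dx)$ with norm $\|f\|_{[0,m]}=\int_0^\infty|f(x)|(1+x^m)\,dx$, and $\omega_{r,m}=2m\tilde r$. Let $T_{0,m}f=-\frac{d}{dx}(rf)-qf$ with domain $D(T_{0,m})$ consisting of all $f\in X_{0,m}$ such that $rf$ is absolutely continuous on every compact subinterval of $\mathbb R_+$, $\frac{d}{dx}(rf)\in X_{0,m}$, $qf\in X_{0,m}$ and, in the case when $1/r$ is integrable near $0$ (that is, $\int_{0^+}dx/r(x)<\infty$), moreover $r(x)f(x)\to0$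 as $x\to0^+$. For $x>0$ let $R(x)=\int_1^x\frac{ds}{r(s)}$ and $Q(x)=\int_1^x\frac{q(s)}{r(s)}\,ds$. Then for each $m\ge1$: 1. Every $\lambda>\omega_{r,m}$ belongs to the resolvent set of $T_{0,m}$, and for all $g\in X_{0,m}$ and almost every $x>0$ $$[R(\lambda,T_{0,m})g](x)=\frac{e^{-\lambda R(x)-Q(x)}}{r(x)}\int_0^x e^{\lambda R(y)+Q(y)}g(y)\,dy ,$$ where the integral converges absolutely for every $x>0$; moreover $$\|R(\lambda,T_{0,m})g\|_{[0,m]}\le\frac{1}{\lambda-\omega_{r,m}}\|g\|_{[0,m]}.$$ 2. $(T_{0,m},D(T_{0,m}))$ is the generator of a strongly continuous, positive semigroup $(S(t))_{t\ge0}$ on $X_{0,m}$ that satisfies $\|S(t)f\|_{[0,m]}\le e^{\omega_{r,m}t}\|f\|_{[0,m]}$ for all $t\ge0$ and $f\in X_{0,m}$. -/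

import Mathlib

open MeasureTheory Set Filter Topology

noncomputable section

namespace GrowthTransport

/-- The measure `(1 + x ^ m) dx` on `(0, ∞)`. -/
def weightMeasure (m : ℝ) : Measure ℝ :=
  (volume.restrict (Ioi (0 : ℝ))).withDensity (fun x => ENNReal.ofReal (1 + x ^ m))

/-- The real Banach lattice `X_{0,m} = L_1((0, ∞), (1 + x ^ m) dx)`, with its usual norm
`‖f‖ = ∫₀^∞ |f x| (1 + x ^ m) dx`. -/
abbrev X (m : ℝ) : Type := Lp ℝ 1 (weightMeasure m)

/-- The weight is positive on `(0, ∞)`, so `weightMeasure m` has the null sets of Lebesgue measure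
on `(0, ∞)`. -/
theorem ae_weightMeasure (m : ℝ) :
    ae (weightMeasure m) = ae (volume.restrict (Ioi (0 : ℝ))) := by
  have hm : Measurable (fun x : ℝ => ENNReal.ofReal (1 + x ^ m)) := by fun_prop
  apply le_antisymm
  · exact (withDensity_absolutelyContinuous _ _).ae_le
  · refine (withDensity_absolutelyContinuous' hm.aemeasurable ?_).ae_le
    filter_upwards [ae_restrict_mem measurableSet_Ioi] with x hx
    have : 0 < 1 + x ^ m := by
      have := Real.rpow_nonneg (le_of_lt hx) m
      linarith
    simpa using this

/-- `h ∈ L_{∞,loc}([0, ∞))`: essentially bounded on `(0, N]` for every `N`. -/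
def MemLinftyLoc (h : ℝ → ℝ) : Prop :=
  ∀ N : ℝ, MemLp h ⊤ (volume.restrict (Ioc 0 N))

/-- `∫_{0+} dx / r(x) < ∞`: the function `1 / r` is integrable on a right neighbourhood of `0`. -/
def InvIntegrableAtZero (r : ℝ → ℝ) : Prop :=
  ∃ ε : ℝ, 0 < ε ∧ IntegrableOn (fun x => 1 / r x) (Ioo 0 ε)

/-- `φ ∈ AC(0, ∞)`: absolutely continuous on every compact subinterval of `(0, ∞)`. -/
def IsLocAC (φ : ℝ → ℝ) : Prop :=
  ∀ α β : ℝ, 0 < α → α ≤ β → AbsolutelyContinuousOnInterval φ α β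

/-- `φ` is the absolutely continuous representative of `r f`, and `f` satisfies all the conditions
for membership in the domain of the transport operator: `(r f)'` and `q f` belong to `X_{0,m}`,
and `r f → 0` at `0` in the case `∫_{0+} dx / r(x) < ∞`. -/
structure IsDomainRep (r q : ℝ → ℝ) {m : ℝ} (f : X m) (φ : ℝ → ℝ) : Prop where
  rep : ∀ᵐ x ∂(volume.restrict (Ioi (0 : ℝ))), φ x = r x * f x
  ac : IsLocAC φ
  deriv_mem : MemLp (deriv φ) 1 (weightMeasure m)
  absorption_mem : MemLp (fun x => q x * f x) 1 (weightMeasure m)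
  boundary : InvIntegrableAtZero r → Tendsto φ (𝓝[>] 0) (𝓝 0)

theorem IsLocAC.ae_differentiableAt {φ : ℝ → ℝ} (h : IsLocAC φ) :
    ∀ᵐ x ∂(volume.restrict (Ioi (0 : ℝ))), DifferentiableAt ℝ φ x := by
  rw [ae_restrict_iff' measurableSet_Ioi]
  have key : ∀ n : ℕ, ∀ᵐ x : ℝ, x ∈ uIcc (1 / ((n : ℝ) + 1)) ((n : ℝ) + 1) →
      DifferentiableAt ℝ φ x := by
    intro n
    have hn : (0 : ℝ) < (n : ℝ) + 1 := by positivity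
    have hle : 1 / ((n : ℝ) + 1) ≤ (n : ℝ) + 1 := by
      rw [div_le_iff₀ hn]
      nlinarith [(Nat.cast_nonneg n : (0 : ℝ) ≤ n)]
    exact (h _ _ (by positivity) hle).ae_differentiableAt
  filter_upwards [ae_all_iff.2 key] with x hx hx0
  have hx0' : (0 : ℝ) < x := hx0
  obtain ⟨n₁, h₁⟩ := exists_nat_one_div_lt hx0'
  obtain ⟨n₂, h₂⟩ := exists_nat_gt x
  have hm1 : (n₁ : ℝ) ≤ (max n₁ n₂ : ℕ) := by exact_mod_cast le_max_left n₁ n₂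
  have hm2 : (n₂ : ℝ) ≤ (max n₁ n₂ : ℕ) := by exact_mod_cast le_max_right n₁ n₂
  refine hx (max n₁ n₂) (Icc_subset_uIcc ⟨?_, by linarith⟩)
  refine le_trans (one_div_le_one_div_of_le (by positivity) ?_) h₁.le
  linarith

theorem IsLocAC.continuousOn {φ : ℝ → ℝ} (h : IsLocAC φ) : ContinuousOn φ (Ioi 0) := by
  intro x hx
  have hx0 : (0 : ℝ) < x := hx
  have hc := (h (x / 2) (x + 1) (by linarith) (by linarith)).continuousOn
  refine (hc.continuousAt ?_).continuousWithinAt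
  rw [uIcc_of_le (by linarith)]
  exact Icc_mem_nhds (by linarith) (by linarith)

/-- The absolutely continuous representative is unique on `(0, ∞)`. -/
theorem IsDomainRep.eqOn {r q : ℝ → ℝ} {m : ℝ} {f : X m} {φ ψ : ℝ → ℝ}
    (hφ : IsDomainRep r q f φ) (hψ : IsDomainRep r q f ψ) : EqOn φ ψ (Ioi 0) := by
  refine Measure.eqOn_open_of_ae_eq (μ := volume) ?_ isOpen_Ioi hφ.ac.continuousOn
    hψ.ac.continuousOn
  filter_upwards [hφ.rep, hψ.rep] with x h₁ h₂
  rw [h₁, h₂]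

theorem IsDomainRep.deriv_ae_eq {r q : ℝ → ℝ} {m : ℝ} {f : X m} {φ ψ : ℝ → ℝ}
    (hφ : IsDomainRep r q f φ) (hψ : IsDomainRep r q f ψ) :
    deriv φ =ᵐ[weightMeasure m] deriv ψ := by
  rw [EventuallyEq, ae_weightMeasure]
  filter_upwards [ae_restrict_mem measurableSet_Ioi] with x hx
  exact ((hφ.eqOn hψ).eventuallyEq_of_mem (Ioi_mem_nhds hx)).deriv_eq

theorem deriv_add_ae {φ ψ : ℝ → ℝ} (m : ℝ) (hφ : IsLocAC φ) (hψ : IsLocAC ψ) :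
    deriv (φ + ψ) =ᵐ[weightMeasure m] deriv φ + deriv ψ := by
  rw [EventuallyEq, ae_weightMeasure]
  filter_upwards [hφ.ae_differentiableAt, hψ.ae_differentiableAt] with x h₁ h₂
  exact deriv_add h₁ h₂

theorem deriv_smul_ae {φ : ℝ → ℝ} (m c : ℝ) (hφ : IsLocAC φ) :
    deriv (c • φ) =ᵐ[weightMeasure m] c • deriv φ := by
  rw [EventuallyEq, ae_weightMeasure]
  filter_upwards [hφ.ae_differentiableAt] with x h₁
  exact deriv_const_smul c h₁

theorem absorption_add {m : ℝ} (q : ℝ → ℝ) (f g : X m) :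
    (fun x => q x * (f + g : X m) x) =ᵐ[weightMeasure m]
      (fun x => q x * f x) + fun x => q x * g x := by
  filter_upwards [Lp.coeFn_add f g] with x hx
  rw [hx]
  exact mul_add _ _ _

theorem absorption_smul {m : ℝ} (q : ℝ → ℝ) (c : ℝ) (f : X m) :
    (fun x => q x * (c • f : X m) x) =ᵐ[weightMeasure m] c • fun x => q x * f x := by
  filter_upwards [Lp.coeFn_smul c f] with x hx
  simp [hx, mul_left_comm]

theorem IsDomainRep.add {r q : ℝ → ℝ} {m : ℝ} {f g : X m} {φ ψ : ℝ → ℝ}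
    (hφ : IsDomainRep r q f φ) (hψ : IsDomainRep r q g ψ) :
    IsDomainRep r q (f + g) (φ + ψ) where
  rep := by
    have h := Lp.coeFn_add f g
    rw [EventuallyEq, ae_weightMeasure] at h
    filter_upwards [hφ.rep, hψ.rep, h] with x h₁ h₂ h₃
    rw [h₃, Pi.add_apply, Pi.add_apply, h₁, h₂, mul_add]
  ac := fun α β h₀ h₁ => (hφ.ac α β h₀ h₁).add (hψ.ac α β h₀ h₁)
  deriv_mem := (memLp_congr_ae (deriv_add_ae m hφ.ac hψ.ac)).2 (hφ.deriv_mem.add hψ.deriv_mem)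
  absorption_mem :=
    (memLp_congr_ae (absorption_add q f g)).2 (hφ.absorption_mem.add hψ.absorption_mem)
  boundary := fun h => by
    have := (hφ.boundary h).add (hψ.boundary h)
    rwa [add_zero] at this

theorem IsDomainRep.smul {r q : ℝ → ℝ} {m : ℝ} {f : X m} {φ : ℝ → ℝ} (c : ℝ)
    (hφ : IsDomainRep r q f φ) : IsDomainRep r q (c • f) (c • φ) where
  rep := by
    have h := Lp.coeFn_smul c f
    rw [EventuallyEq, ae_weightMeasure] at h
    filter_upwards [hφ.rep, h] with x h₁ h₃
    simp [h₁, h₃, mul_left_comm]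
  ac := fun α β h₀ h₁ => (hφ.ac α β h₀ h₁).const_smul c
  deriv_mem := (memLp_congr_ae (deriv_smul_ae m c hφ.ac)).2 (hφ.deriv_mem.const_smul c)
  absorption_mem := (memLp_congr_ae (absorption_smul q c f)).2 (hφ.absorption_mem.const_smul c)
  boundary := fun h => by
    have := (hφ.boundary h).const_smul c
    rwa [smul_zero] at this

theorem isDomainRep_zero (r q : ℝ → ℝ) (m : ℝ) : IsDomainRep r q (0 : X m) 0 where
  rep := by
    have h := Lp.coeFn_zero ℝ 1 (weightMeasure m)
    rw [EventuallyEq, ae_weightMeasure] at h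
    filter_upwards [h] with x h₃
    rw [h₃]
    exact (mul_zero _).symm
  ac := fun α β _ _ =>
    (LipschitzWith.const (0 : ℝ)).lipschitzOnWith.absolutelyContinuousOnInterval
  deriv_mem := by simp
  absorption_mem := by
    refine (memLp_congr_ae ?_).2 MemLp.zero
    filter_upwards [Lp.coeFn_zero ℝ 1 (weightMeasure m)] with x hx
    rw [hx]
    exact mul_zero _
  boundary := fun _ => tendsto_const_nhds

/-- The domain `D(T_{0,m})`, in both cases `∫_{0+} dx / r(x) = ∞` (no boundary condition) and
`∫_{0+} dx / r(x) < ∞` (with the boundary condition `r f → 0` at `0`). -/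
def transportDomain (r q : ℝ → ℝ) (m : ℝ) : Submodule ℝ (X m) where
  carrier := {f | ∃ φ : ℝ → ℝ, IsDomainRep r q f φ}
  add_mem' := fun ⟨φ, hφ⟩ ⟨ψ, hψ⟩ => ⟨φ + ψ, hφ.add hψ⟩
  zero_mem' := ⟨0, isDomainRep_zero r q m⟩
  smul_mem' := fun c _ ⟨φ, hφ⟩ => ⟨c • φ, hφ.smul c⟩

/-- The class of `-φ' - q f` in `X_{0,m}`, where `φ` is the representative of `r f`. -/
def transportValue {r q : ℝ → ℝ} {m : ℝ} {f : X m} {φ : ℝ → ℝ} (h : IsDomainRep r q f φ) : X m :=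
  MemLp.toLp (fun x => - deriv φ x - q x * f x) (h.deriv_mem.neg.sub h.absorption_mem)

theorem transportValue_unique {r q : ℝ → ℝ} {m : ℝ} {f : X m} {φ ψ : ℝ → ℝ}
    (hφ : IsDomainRep r q f φ) (hψ : IsDomainRep r q f ψ) :
    transportValue hφ = transportValue hψ := by
  refine (MemLp.toLp_eq_toLp_iff _ _).2 ?_
  filter_upwards [hφ.deriv_ae_eq hψ] with x hx
  rw [hx]

theorem transportValue_add {r q : ℝ → ℝ} {m : ℝ} {f g : X m} {φ ψ : ℝ → ℝ}
    (hφ : IsDomainRep r q f φ) (hψ : IsDomainRep r q g ψ) :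
    transportValue (hφ.add hψ) = transportValue hφ + transportValue hψ := by
  rw [transportValue, transportValue, transportValue, ← MemLp.toLp_add]
  refine (MemLp.toLp_eq_toLp_iff _ _).2 ?_
  filter_upwards [deriv_add_ae m hφ.ac hψ.ac, absorption_add q f g] with x h₁ h₂
  simp only [Pi.add_apply] at h₁ h₂ ⊢
  rw [h₁, h₂]
  ring

theorem transportValue_smul {r q : ℝ → ℝ} {m : ℝ} {f : X m} {φ : ℝ → ℝ} (c : ℝ)
    (hφ : IsDomainRep r q f φ) :
    transportValue (hφ.smul c) = c • transportValue hφ := by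
  rw [transportValue, transportValue, ← MemLp.toLp_const_smul]
  refine (MemLp.toLp_eq_toLp_iff _ _).2 ?_
  filter_upwards [deriv_smul_ae m c hφ.ac, absorption_smul q c f] with x h₁ h₂
  simp only [Pi.smul_apply, smul_eq_mul] at h₁ h₂ ⊢
  rw [h₁, h₂]
  ring

/-- The operator `T_{0,m} f = -(r f)' - q f` with domain `D(T_{0,m})`. -/
def transportOp (r q : ℝ → ℝ) (m : ℝ) : X m →ₗ.[ℝ] X m where
  domain := transportDomain r q m
  toFun :=
    { toFun := fun f => transportValue f.2.choose_spec
      map_add' := fun f g => by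
        rw [← transportValue_add]
        exact transportValue_unique _ _
      map_smul' := fun c f => by
        rw [RingHom.id_apply, ← transportValue_smul]
        exact transportValue_unique _ _ }

/-- The value of `T_{0,m} f` does not depend on the choice of the representative. -/
theorem transportOp_apply {r q : ℝ → ℝ} {m : ℝ} {f : X m} {φ : ℝ → ℝ} (h : IsDomainRep r q f φ) :
    transportOp r q m ⟨f, φ, h⟩ = transportValue h :=
  transportValue_unique (Exists.choose_spec (⟨φ, h⟩ : ∃ ψ, IsDomainRep r q f ψ)) h

/-- The antiderivative `x ↦ ∫₁ˣ h(s) / r(s) ds` of `h / r`; it is `R` for `h = 1` and `Q` for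
`h = q`. -/
def antideriv (h r : ℝ → ℝ) (x : ℝ) : ℝ := ∫ s in (1 : ℝ)..x, h s / r s

/-- The integrand `y ↦ exp (l R(y) + Q(y)) g(y)` of the resolvent formula. -/
def resolventIntegrand (r q : ℝ → ℝ) (l : ℝ) (g : ℝ → ℝ) (y : ℝ) : ℝ :=
  Real.exp (l * antideriv 1 r y + antideriv q r y) * g y

/-- `[ℛ(l) g](x) = (exp (-l R(x) - Q(x)) / r(x)) ∫₀ˣ exp (l R(y) + Q(y)) g(y) dy`. -/
def resolventFormula (r q : ℝ → ℝ) (l : ℝ) (g : ℝ → ℝ) (x : ℝ) : ℝ :=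
  Real.exp (-l * antideriv 1 r x - antideriv q r x) / r x *
    ∫ y in (0 : ℝ)..x, resolventIntegrand r q l g y

variable {E : Type*} [NormedAddCommGroup E] [NormedSpace ℝ E]

/-- The bounded operator `J` is the resolvent `R(l, T) = (l - T)⁻¹`: it maps `E` into `D(T)` and
is a two-sided inverse of `l - T : D(T) → E`. -/
def IsResolvent (T : E →ₗ.[ℝ] E) (l : ℝ) (J : E →L[ℝ] E) : Prop :=
  (∀ g : E, ∃ h : J g ∈ T.domain, l • J g - T ⟨J g, h⟩ = g) ∧
    ∀ f : T.domain, J (l • (f : E) - T f) = f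

/-- `(S(t))_{t ≥ 0}` is a strongly continuous one-parameter semigroup of bounded operators; only
the values of `S` on `[0, ∞)` matter. -/
structure IsC0Semigroup (S : ℝ → E →L[ℝ] E) : Prop where
  zero : S 0 = ContinuousLinearMap.id ℝ E
  add : ∀ s t : ℝ, 0 ≤ s → 0 ≤ t → S (s + t) = (S s).comp (S t)
  continuousOn : ∀ f : E, ContinuousOn (fun t => S t f) (Ici 0)

/-- `T`, with exactly its domain, is the infinitesimal generator of `S`: a vector `f` belongs to
`D(T)` and `T f = g` if and only if `(S(t) f - f) / t → g` as `t → 0+`. -/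
def IsGeneratorOf (T : E →ₗ.[ℝ] E) (S : ℝ → E →L[ℝ] E) : Prop :=
  ∀ f g : E, (∃ h : f ∈ T.domain, T ⟨f, h⟩ = g) ↔
    Tendsto (fun t : ℝ => t⁻¹ • (S t f - f)) (𝓝[>] 0) (𝓝 g)

end GrowthTransport

end

open scoped ENNReal ContDiff

namespace GrowthTransport

/-! ### Semigroups as strong limits of exponentials of bounded operators. -/

section HilleYosida

open NormedSpace

variable {E : Type*} [NormedAddCommGroup E] [NormedSpace ℝ E]

/-! The equation `l f - T f = g` is the linear first-order ODE `φ' + ((l + q) / r) φ = g` for the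
flux `φ = r f`. Its integrating factor is `exp (l R + Q)`, and integrating from `0` gives the
resolvent formula. This solution is the only one in the domain. Two solutions differ by `c exp (-l R
- Q)`. The boundary condition forces `c = 0` when `1 / r` is integrable at `0`; otherwise `c ≠ 0`
would bound `1 / r` near `0` by a multiple of the integrable function `|f|`
(`Admissible.flux_eq_of_isDomainRep`).

The norm bound is an energy estimate. Multiply the ODE by the weight `w = 1 + x ^ m` and integrate.
Since `r ≤ ρ (1 + x)` with `ρ = max r₀ r₁`, one has `r w' ≤ 2 m ρ w`, so the term that arises from
differentiating the weight costs at most `2 m ρ`. For nonnegative data the flux at the right end has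
a good sign, and the flux at the left end vanishes in the limit. What remains bounds `(l - 2 m ρ +
q) f` in norm by `g` (`Admissible.lintegral_resolventFormula_le`), which yields both the resolvent
bound and `q f ∈ X`.

The domain is dense because it contains `φ / r` for every `C¹` function `φ` with compact support in
`(0, ∞)`, and such `φ` approximate `r f` in `L¹` of the measure `w / r dx`
(`Admissible.dense_transportDomain`).

The semigroup then comes from the Hille–Yosida theorem (`hilleYosida`), proved here through Yosida
approximations. Their exponentials are, up to a positive scalar, power series in the resolvent with
nonnegative coefficients. Positivity of the resolvent therefore passes to the semigroup. -/

theorem IsC0Semigroup.hasDerivWithinAt_of_tendsto {S : ℝ → E →L[ℝ] E} (hS : IsC0Semigroup S)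
    {f g : E} (h : Tendsto (fun t : ℝ => t⁻¹ • (S t f - f)) (𝓝[>] 0) (𝓝 g)) {t : ℝ} (ht : 0 ≤ t) :
    HasDerivWithinAt (fun s => S s f) (S t g) (Ici t) t := by
  rw [← hasDerivWithinAt_Ioi_iff_Ici, hasDerivWithinAt_iff_tendsto_slope' (by simp)]
  have h1 : Tendsto (fun s : ℝ => s - t) (𝓝[>] t) (𝓝[>] 0) := by
    refine tendsto_nhdsWithin_iff.2 ⟨?_, ?_⟩
    · have : Tendsto (fun s : ℝ => s - t) (𝓝 t) (𝓝 (t - t)) :=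
        tendsto_id.sub_const t
      rw [sub_self] at this
      exact this.mono_left nhdsWithin_le_nhds
    · filter_upwards [self_mem_nhdsWithin] with s hs
      exact mem_Ioi.2 (sub_pos.2 (mem_Ioi.1 hs))
  refine (((S t).continuous.tendsto g).comp (h.comp h1)).congr' ?_
  filter_upwards [self_mem_nhdsWithin] with s hs
  have : S s = (S t).comp (S (s - t)) := by
    rw [← hS.add t (s - t) ht (sub_nonneg.2 (le_of_lt hs))]; simp
  simp [slope, this]

/-- A generator with a resolvent at one point above the growth bound of the semigroup has no proper
extension which is the infinitesimal generator. -/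
theorem IsC0Semigroup.mem_domain_of_tendsto {S : ℝ → E →L[ℝ] E} (hS : IsC0Semigroup S) {w l : ℝ}
    (hbound : ∀ t : ℝ, 0 ≤ t → ∀ f, ‖S t f‖ ≤ Real.exp (w * t) * ‖f‖) (hwl : w < l)
    {T : E →ₗ.[ℝ] E} {J : E →L[ℝ] E} (hJ : IsResolvent T l J)
    (hT : ∀ f : T.domain, Tendsto (fun t : ℝ => t⁻¹ • (S t f - f)) (𝓝[>] 0) (𝓝 (T f)))
    {f g : E} (h : Tendsto (fun t : ℝ => t⁻¹ • (S t f - f)) (𝓝[>] 0) (𝓝 g)) :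
    ∃ hf : f ∈ T.domain, T ⟨f, hf⟩ = g := by
  obtain ⟨hd, hh⟩ := hJ.1 (l • f - g)
  set k := J (l • f - g) with hk
  -- `f - k` behaves as an eigenvector of the generator for the eigenvalue `l`, because `T k = l k -
  -- (l f - g)`.
  have hu : Tendsto (fun t : ℝ => t⁻¹ • (S t (f - k) - (f - k))) (𝓝[>] 0) (𝓝 (l • (f - k))) := by
    have h1 := h.sub (hT ⟨k, hd⟩)
    have : g - T ⟨k, hd⟩ = l • (f - k) := by
      rw [smul_sub]
      have e : T ⟨k, hd⟩ = l • k - (l • f - g) := by rw [← hh]; abel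
      rw [e]; abel
    rw [this] at h1
    refine h1.congr fun t => ?_
    simp only [map_sub, ← smul_sub]
    congr 1
    abel
  set u := f - k with hu_def
  -- An eigenvector would evolve as `exp (l t) u`, which the growth bound `exp (w t)` with `w < l`
  -- allows only for `u = 0`.
  have hconst : ∀ t : ℝ, 0 ≤ t → Real.exp (-l * t) • S t u = u := by
    intro t ht
    have hder : ∀ s ∈ Ico (0 : ℝ) t,
        HasDerivWithinAt (fun s => Real.exp (-l * s) • S s u) 0 (Ici s) s := by
      intro s hs
      have h1 : HasDerivWithinAt (fun s : ℝ => Real.exp (-l * s)) (Real.exp (-l * s) * -l)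
          (Ici s) s := by
        have := ((hasDerivAt_id s).const_mul (-l)).exp
        simpa using this.hasDerivWithinAt
      refine (h1.smul (hS.hasDerivWithinAt_of_tendsto hu hs.1)).congr_deriv ?_
      simp [smul_smul]
    have hc : ContinuousOn (fun s => Real.exp (-l * s) • S s u) (Icc 0 t) := by
      refine ContinuousOn.smul (by fun_prop) ((hS.continuousOn u).mono Icc_subset_Ici_self)
    have := constant_of_has_deriv_right_zero hc hder t ⟨ht, le_rfl⟩
    simpa [hS.zero] using this
  have hle : ∀ t : ℝ, 0 ≤ t → ‖u‖ ≤ Real.exp (-((l - w) * t)) * ‖u‖ := by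
    intro t ht
    calc ‖u‖ = ‖Real.exp (-l * t) • S t u‖ := by rw [hconst t ht]
      _ ≤ Real.exp (-l * t) * (Real.exp (w * t) * ‖u‖) := by
        rw [norm_smul, Real.norm_of_nonneg (Real.exp_nonneg _)]
        gcongr
        exact hbound t ht u
      _ = Real.exp (-((l - w) * t)) * ‖u‖ := by
        rw [← mul_assoc, ← Real.exp_add]; ring_nf
  have hlim : Tendsto (fun t : ℝ => Real.exp (-((l - w) * t)) * ‖u‖) atTop (𝓝 (0 * ‖u‖)) := by
    refine Tendsto.mul_const _ (Real.tendsto_exp_neg_atTop_nhds_zero.comp ?_)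
    exact tendsto_id.const_mul_atTop (sub_pos.2 hwl)
  have h0 : ‖u‖ ≤ 0 * ‖u‖ := by
    refine ge_of_tendsto hlim ?_
    filter_upwards [eventually_ge_atTop 0] with t ht using hle t ht
  have hfk : f = k := by
    have : u = 0 := norm_le_zero_iff.1 (by simpa using h0)
    exact sub_eq_zero.1 this
  refine ⟨hfk ▸ hd, ?_⟩
  have e : T ⟨k, hd⟩ = g := by
    have : T ⟨k, hd⟩ = l • k - (l • f - g) := by rw [← hh]; abel
    rw [this, hfk]; abel
  rw [← e]
  congr 1
  exact Subtype.ext hfk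

variable [CompleteSpace E]

theorem norm_exp_le_exp_norm (A : E →L[ℝ] E) : ‖exp A‖ ≤ Real.exp ‖A‖ := by
  have h1 := exp_series_hasSum_exp' (𝕂 := ℝ) A
  have h2 : HasSum (fun n : ℕ => ((n.factorial : ℝ)⁻¹) • ‖A‖ ^ n) (Real.exp ‖A‖) := by
    rw [Real.exp_eq_exp_ℝ]
    exact exp_series_hasSum_exp' (𝕂 := ℝ) ‖A‖
  rw [← h1.tsum_eq]
  refine tsum_of_norm_bounded h2 fun n => ?_
  rw [norm_smul, smul_eq_mul, Real.norm_of_nonneg (by positivity)]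
  gcongr
  -- The term `n = 0` needs `‖1‖ ≤ 1`; equality fails when `E` is trivial.
  rcases n with _ | n
  · simpa using! ContinuousLinearMap.norm_id_le (𝕜 := ℝ) (E := E)
  · exact norm_pow_le' A (Nat.succ_pos n)

theorem exp_add_smul (A : E →L[ℝ] E) (s t : ℝ) :
    exp ((s + t) • A) = exp (s • A) * exp (t • A) := by
  let _ : NormedAlgebra ℚ (E →L[ℝ] E) := NormedAlgebra.restrictScalars ℚ ℝ _
  rw [add_smul]
  exact exp_add_of_commute (((Commute.refl A).smul_left s).smul_right t)

theorem hasDerivAt_exp_smul_apply (A : E →L[ℝ] E) (f : E) (t : ℝ) :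
    HasDerivAt (fun s : ℝ => exp (s • A) f) (exp (t • A) (A f)) t :=
  (hasDerivAt_exp_smul_const A t).clm_apply (hasDerivAt_const t f) |>.congr_deriv (by simp)

/-- The path `s ↦ exp (s A) exp ((t - s) B) f` joins the two vectors. By commutativity its
derivative is `exp (s A) exp ((t - s) B) (A f - B f)`, and the two exponential bounds multiply to
`exp (K t)` for every `s`. -/
theorem norm_exp_smul_sub_le {A B : E →L[ℝ] E} (hAB : Commute A B) {K : ℝ}
    (hA : ∀ t : ℝ, 0 ≤ t → ‖exp (t • A)‖ ≤ Real.exp (K * t))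
    (hB : ∀ t : ℝ, 0 ≤ t → ‖exp (t • B)‖ ≤ Real.exp (K * t)) {t : ℝ} (ht : 0 ≤ t) (f : E) :
    ‖exp (t • A) f - exp (t • B) f‖ ≤ Real.exp (K * t) * ‖A f - B f‖ * t := by
  let _ : NormedAlgebra ℚ (E →L[ℝ] E) := NormedAlgebra.restrictScalars ℚ ℝ _
  have hder : ∀ s : ℝ, HasDerivAt (fun s : ℝ => exp (s • A) (exp ((t - s) • B) f))
      (exp (s • A) (exp ((t - s) • B) (A f - B f))) s := by
    intro s
    have h1 := hasDerivAt_exp_smul_const A s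
    have h2 : HasDerivAt (fun s : ℝ => exp ((t - s) • B) f)
        (-(exp ((t - s) • B) (B f))) s := by
      have := (hasDerivAt_exp_smul_apply B f (t - s)).scomp s ((hasDerivAt_id s).const_sub t)
      simpa [Function.comp_def] using this
    refine (h1.clm_apply h2).congr_deriv ?_
    have hc : A (exp ((t - s) • B) f) = exp ((t - s) • B) (A f) := by
      have : Commute A (exp ((t - s) • B)) := (hAB.smul_right (t - s)).exp_right
      exact congrArg (fun C : E →L[ℝ] E => C f) this
    simp [hc, ← sub_eq_add_neg]
  have := norm_image_sub_le_of_norm_deriv_le_segment' (a := 0) (b := t)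
    (C := Real.exp (K * t) * ‖A f - B f‖) (fun s _ => (hder s).hasDerivWithinAt)
    (fun s hs => ?_) t ⟨ht, le_rfl⟩
  · simpa using this
  · have e1 := hA s hs.1
    have e2 := hB (t - s) (by linarith [hs.2])
    have : Real.exp (K * t) = Real.exp (K * s) * Real.exp (K * (t - s)) := by
      rw [← Real.exp_add]; ring_nf
    rw [this, mul_assoc]
    refine (ContinuousLinearMap.le_opNorm _ _).trans ?_
    refine mul_le_mul e1 ((ContinuousLinearMap.le_opNorm _ _).trans ?_) (norm_nonneg _)
      (Real.exp_nonneg _)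
    gcongr

/-- On `D` the difference of two exponentials is controlled by `A i f - A j f`; the bound `exp (K
b)`, uniform in `n` and `t`, carries this over to the closure of `D`. -/
theorem uniformCauchySeqOn_exp_smul {A : ℕ → E →L[ℝ] E} (hcomm : ∀ i j, Commute (A i) (A j))
    {K : ℝ} (hK : 0 ≤ K) (hA : ∀ n (t : ℝ), 0 ≤ t → ‖exp (t • A n)‖ ≤ Real.exp (K * t))
    {D : Set E} (hD : Dense D) (hconv : ∀ f ∈ D, CauchySeq fun n => A n f) (f : E) (b : ℝ) :
    UniformCauchySeqOn (fun n (t : ℝ) => exp (t • A n) f) atTop (Icc 0 b) := by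
  rcases lt_or_ge b 0 with hb | hb
  · rw [Icc_eq_empty (not_le.2 hb)]
    intro u _
    simp
  rw [Metric.uniformCauchySeqOn_iff]
  intro ε hε
  set M := Real.exp (K * b) with hM
  have hMpos : 0 < M := Real.exp_pos _
  have hAM : ∀ n, ∀ t ∈ Icc (0 : ℝ) b, ‖exp (t • A n)‖ ≤ M := fun n t ht =>
    (hA n t ht.1).trans (Real.exp_le_exp.2 (mul_le_mul_of_nonneg_left ht.2 hK))
  obtain ⟨g, hgD, hg⟩ := hD.exists_dist_lt f (ε := ε / (4 * M)) (by positivity)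
  -- The factor `b + 1` in place of `b` keeps the denominator positive when `b = 0`.
  obtain ⟨N, hN⟩ := Metric.cauchySeq_iff.1 (hconv g hgD) (ε / (4 * M * (b + 1))) (by positivity)
  have hfg : ∀ n, ∀ t ∈ Icc (0 : ℝ) b, ‖exp (t • A n) f - exp (t • A n) g‖ ≤ ε / 4 := by
    intro n t ht
    rw [← map_sub]
    calc ‖exp (t • A n) (f - g)‖ ≤ M * (ε / (4 * M)) := by
          refine (ContinuousLinearMap.le_opNorm _ _).trans ?_
          gcongr
          · exact hAM n t ht
          · rw [← dist_eq_norm]; exact hg.le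
      _ = ε / 4 := by field_simp
  refine ⟨N, fun i hi j hj t ht => ?_⟩
  have h2 : ‖exp (t • A i) g - exp (t • A j) g‖ ≤ ε / 4 := by
    calc _ ≤ Real.exp (K * t) * ‖A i g - A j g‖ * t :=
          norm_exp_smul_sub_le (hcomm i j) (hA i) (hA j) ht.1 g
      _ ≤ M * (ε / (4 * M * (b + 1))) * (b + 1) := by
          have := (hN i hi j hj).le
          rw [dist_eq_norm] at this
          have h3 : Real.exp (K * t) ≤ M := Real.exp_le_exp.2 (mul_le_mul_of_nonneg_left ht.2 hK)
          have h4 : t ≤ b + 1 := by linarith [ht.2]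
          have h5 := ht.1
          gcongr
      _ = ε / 4 := by field_simp
  have h1 := hfg i t ht
  have h3 := hfg j t ht
  rw [dist_eq_norm]
  have : exp (t • A i) f - exp (t • A j) f = (exp (t • A i) f - exp (t • A i) g) +
      (exp (t • A i) g - exp (t • A j) g) - (exp (t • A j) f - exp (t • A j) g) := by abel
  rw [this]
  have h4 := norm_sub_le ((exp (t • A i) f - exp (t • A i) g) +
      (exp (t • A i) g - exp (t • A j) g)) (exp (t • A j) f - exp (t • A j) g)
  have h5 := norm_add_le (exp (t • A i) f - exp (t • A i) g) (exp (t • A i) g - exp (t • A j) g)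
  linarith

/-- The mean value inequality is applied to `exp (s A n) f - s g` for fixed `n`, with a bound on the
derivative that is uniform for small `s`. The estimate survives `n → ∞`, so the limit need not be
differentiated. -/
theorem tendsto_slope_of_uniform_limit {A : ℕ → E →L[ℝ] E}
    {K : ℝ} (hK : 0 ≤ K) (hA : ∀ n (t : ℝ), 0 ≤ t → ‖exp (t • A n)‖ ≤ Real.exp (K * t))
    {S : ℝ → E →L[ℝ] E} (hS : IsC0Semigroup S)
    (hlim : ∀ f b, TendstoUniformlyOn (fun n (t : ℝ) => exp (t • A n) f) (fun t => S t f)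
      atTop (Icc 0 b)) {f g : E} (hfg : Tendsto (fun n => A n f) atTop (𝓝 g)) :
    Tendsto (fun t : ℝ => t⁻¹ • (S t f - f)) (𝓝[>] 0) (𝓝 g) := by
  rw [Metric.tendsto_nhds]
  intro ε hε
  have hc : ContinuousWithinAt (fun t => S t g) (Ici 0) 0 := hS.continuousOn g 0 self_mem_Ici
  obtain ⟨δ, hδ, hδg⟩ := Metric.continuousWithinAt_iff.1 hc (ε / 6) (by positivity)
  -- The cap at `1` makes `exp (K s) ≤ exp K` on the interval.
  set b := min (δ / 2) 1 with hb
  have hbpos : 0 < b := by positivity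
  have hbδ : b < δ := (min_le_left _ _).trans_lt (by linarith)
  have h1 : ∀ᶠ n in atTop, ∀ t ∈ Icc (0 : ℝ) b, dist (S t g) (exp (t • A n) g) < ε / 6 :=
    Metric.tendstoUniformlyOn_iff.1 (hlim g b) _ (by positivity)
  have h2 : ∀ᶠ n in atTop, ‖A n f - g‖ < ε / (6 * Real.exp K) := by
    have := Metric.tendsto_nhds.1 hfg (ε / (6 * Real.exp K)) (by positivity)
    simpa [dist_eq_norm] using this
  have key : ∀ t ∈ Ioc (0 : ℝ) b, ‖S t f - f - t • g‖ ≤ ε / 2 * t := by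
    intro t ht
    have hl : Tendsto (fun n => ‖exp (t • A n) f - f - t • g‖) atTop (𝓝 ‖S t f - f - t • g‖) :=
      ((((hlim f b).tendsto_at ⟨ht.1.le, ht.2⟩).sub_const f).sub_const (t • g)).norm
    refine le_of_tendsto hl ?_
    filter_upwards [h1, h2] with n hn1 hn2
    have hder : ∀ s : ℝ, HasDerivAt (fun s : ℝ => exp (s • A n) f - s • g)
        (exp (s • A n) (A n f) - g) s := fun s =>
      (hasDerivAt_exp_smul_apply (A n) f s).sub
        (((hasDerivAt_id s).smul_const g).congr_deriv (by simp))
    have := norm_image_sub_le_of_norm_deriv_le_segment' (a := 0) (b := t)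
      (C := ε / 2) (fun s _ => (hder s).hasDerivWithinAt)
      (fun s hs => ?_) t ⟨ht.1.le, le_rfl⟩
    · simpa [sub_right_comm] using this
    · have hsb : s ∈ Icc (0 : ℝ) b := ⟨hs.1, hs.2.le.trans ht.2⟩
      have e1 : ‖exp (s • A n) (A n f - g)‖ ≤ ε / 6 := by
        calc _ ≤ Real.exp K * (ε / (6 * Real.exp K)) := by
              refine (ContinuousLinearMap.le_opNorm _ _).trans ?_
              gcongr
              refine (hA n s hs.1).trans (Real.exp_le_exp.2 ?_)
              exact mul_le_of_le_one_right hK (hsb.2.trans (min_le_right _ _))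
          _ = ε / 6 := by field_simp
      have e2 : ‖S s g - exp (s • A n) g‖ < ε / 6 := by
        rw [← dist_eq_norm]; exact hn1 s hsb
      have e3 : ‖S s g - g‖ < ε / 6 := by
        have := hδg (x := s) hs.1 (by
          rw [Real.dist_eq, sub_zero, abs_of_nonneg hs.1]; exact hsb.2.trans_lt hbδ)
        rwa [hS.zero, ContinuousLinearMap.id_apply, dist_eq_norm] at this
      -- The three errors are the convergence of `A n f`, that of the exponentials at `g`, and the
      -- continuity of `S` at `0`.
      have e4 : exp (s • A n) (A n f) - g =
          exp (s • A n) (A n f - g) - (S s g - exp (s • A n) g) + (S s g - g) := by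
        rw [map_sub]; abel
      rw [e4]
      have e5 := norm_add_le (exp (s • A n) (A n f - g) - (S s g - exp (s • A n) g)) (S s g - g)
      have e6 := norm_sub_le (exp (s • A n) (A n f - g)) (S s g - exp (s • A n) g)
      linarith
  have hmem : Ioc (0 : ℝ) b ∈ 𝓝[>] (0 : ℝ) := Ioc_mem_nhdsGT hbpos
  filter_upwards [hmem] with t ht
  have h0 : t⁻¹ • (S t f - f) - g = t⁻¹ • (S t f - f - t • g) := by
    rw [smul_sub t⁻¹ (S t f - f), smul_smul, inv_mul_cancel₀ ht.1.ne', one_smul]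
  rw [dist_eq_norm, h0, norm_smul, Real.norm_of_nonneg (by have := ht.1; positivity)]
  calc t⁻¹ * ‖S t f - f - t • g‖ ≤ t⁻¹ * (ε / 2 * t) := by
        have := key t ht
        have h5 := ht.1
        gcongr
    _ = ε / 2 := by have := ht.1.ne'; field_simp
    _ < ε := by linarith

/-- Strong limits of the exponentials of commuting bounded operators which converge to `T` on a
dense domain form a semigroup, and `T` is its generator if `T` has a resolvent above the growth
bound. -/
theorem exists_semigroup_of_bounded_approx {A : ℕ → E →L[ℝ] E}
    (hcomm : ∀ i j, Commute (A i) (A j)) {K w l : ℝ} (hK : 0 ≤ K) {v : ℕ → ℝ}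
    (hv : ∀ n, v n ≤ K) (hvw : Tendsto v atTop (𝓝 w))
    (hA : ∀ n (t : ℝ), 0 ≤ t → ‖exp (t • A n)‖ ≤ Real.exp (v n * t))
    {T : E →ₗ.[ℝ] E} (hT : Dense (T.domain : Set E))
    (hAT : ∀ f : T.domain, Tendsto (fun n => A n f) atTop (𝓝 (T f)))
    {J : E →L[ℝ] E} (hwl : w < l) (hJ : IsResolvent T l J) :
    ∃ S : ℝ → E →L[ℝ] E, IsC0Semigroup S ∧ IsGeneratorOf T S ∧
      (∀ t : ℝ, 0 ≤ t → ∀ f, ‖S t f‖ ≤ Real.exp (w * t) * ‖f‖) ∧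
      ∀ t : ℝ, 0 ≤ t → ∀ f, Tendsto (fun n => exp (t • A n) f) atTop (𝓝 (S t f)) := by
  have hAK : ∀ n (t : ℝ), 0 ≤ t → ‖exp (t • A n)‖ ≤ Real.exp (K * t) := fun n t ht =>
    (hA n t ht).trans (Real.exp_le_exp.2 (mul_le_mul_of_nonneg_right (hv n) ht))
  have hcauchy := uniformCauchySeqOn_exp_smul hcomm hK hAK hT
    fun f hf => (hAT ⟨f, hf⟩).cauchySeq
  have hex : ∀ t : ℝ, ∃ B : E →L[ℝ] E, 0 ≤ t →
      ∀ f, Tendsto (fun n => exp (t • A n) f) atTop (𝓝 (B f)) := by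
    intro t
    by_cases ht : 0 ≤ t
    · have : ∀ f, ∃ y, Tendsto (fun n => exp (t • A n) f) atTop (𝓝 y) := fun f =>
        cauchySeq_tendsto_of_complete ((hcauchy f t).cauchySeq ⟨ht, le_rfl⟩)
      choose y hy using this
      exact ⟨continuousLinearMapOfTendsto (fun n => exp (t • A n)) (tendsto_pi_nhds.2 hy),
        fun _ f => hy f⟩
    · exact ⟨0, fun h => absurd h ht⟩
  choose S hS using hex
  -- The crude rate `K` gives uniformity in `n`; the sharp rate `w` appears only in the limit of `v
  -- n`.
  have hbound : ∀ t : ℝ, 0 ≤ t → ∀ f, ‖S t f‖ ≤ Real.exp (w * t) * ‖f‖ := by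
    intro t ht f
    refine le_of_tendsto_of_tendsto (hS t ht f).norm
      (((Real.continuous_exp.tendsto _).comp (hvw.mul_const t)).mul_const ‖f‖) ?_
    exact Eventually.of_forall fun n => (ContinuousLinearMap.le_opNorm _ _).trans
      (mul_le_mul_of_nonneg_right (hA n t ht) (norm_nonneg _))
  have hunif : ∀ f b, TendstoUniformlyOn (fun n (t : ℝ) => exp (t • A n) f) (fun t => S t f)
      atTop (Icc 0 b) := fun f b =>
    (hcauchy f b).tendstoUniformlyOn_of_tendsto fun t ht => hS t ht.1 f
  have hsemi : IsC0Semigroup S := by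
    refine ⟨?_, ?_, ?_⟩
    · ext f
      refine tendsto_nhds_unique (hS 0 le_rfl f) ?_
      simp
    · intro s t hs ht
      ext f
      refine tendsto_nhds_unique (hS (s + t) (add_nonneg hs ht) f) ?_
      rw [ContinuousLinearMap.comp_apply, tendsto_iff_norm_sub_tendsto_zero]
      have h1 := tendsto_iff_norm_sub_tendsto_zero.1 (hS s hs (S t f))
      have h2 := (tendsto_iff_norm_sub_tendsto_zero.1 (hS t ht f)).const_mul (Real.exp (K * s))
      have h3 := h2.add h1
      rw [mul_zero, add_zero] at h3
      refine squeeze_zero (fun _ => norm_nonneg _) (fun n => ?_) h3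
      have e : exp ((s + t) • A n) f - S s (S t f) =
          exp (s • A n) (exp (t • A n) f - S t f) + (exp (s • A n) (S t f) - S s (S t f)) := by
        rw [exp_add_smul, mul_apply_eq_comp, map_sub]; abel
      rw [e]
      refine (norm_add_le _ _).trans (add_le_add_left ?_ _)
      exact (ContinuousLinearMap.le_opNorm _ _).trans
        (mul_le_mul_of_nonneg_right (hAK n s hs) (norm_nonneg _))
    · intro f t ht
      have hc : ContinuousOn (fun t => S t f) (Icc 0 (t + 1)) := by
        refine (hunif f (t + 1)).continuousOn (Frequently.of_forall fun n => ?_)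
        exact fun s _ =>
          (hasDerivAt_exp_smul_apply (A n) f s).continuousAt.continuousWithinAt
      refine (hc t ⟨ht, by linarith⟩).mono_of_mem_nhdsWithin ?_
      filter_upwards [self_mem_nhdsWithin, mem_nhdsWithin_of_mem_nhds (Iio_mem_nhds
        (show t < t + 1 by linarith))] with s h1 h2
      exact ⟨h1, le_of_lt h2⟩
  have hgen : ∀ f : T.domain, Tendsto (fun t : ℝ => t⁻¹ • (S t f - f)) (𝓝[>] 0) (𝓝 (T f)) :=
    fun f => tendsto_slope_of_uniform_limit hK hAK hsemi hunif (hAT f)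
  refine ⟨S, hsemi, fun f g => ⟨?_, hsemi.mem_domain_of_tendsto hbound hwl hJ hgen⟩, hbound, hS⟩
  rintro ⟨hf, rfl⟩
  exact hgen ⟨f, hf⟩

end HilleYosida

/-! ### Yosida approximations and the Hille–Yosida theorem. -/

section HilleYosida

open NormedSpace

variable {E : Type*} [NormedAddCommGroup E] [NormedSpace ℝ E]

/-- The Yosida approximation `l² R(l, T) - l` of `T`, in terms of the resolvent `J = R(l, T)`. -/
noncomputable def yosidaApprox (l : ℝ) (J : E →L[ℝ] E) : E →L[ℝ] E := l ^ 2 • J - l • 1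

/-- Apply `J` to `(l - T) H g = (l - k) H g + g`. -/
theorem IsResolvent.resolvent_identity {T : E →ₗ.[ℝ] E} {l k : ℝ} {J H : E →L[ℝ] E}
    (hJ : IsResolvent T l J) (hH : IsResolvent T k H) (g : E) :
    H g = (l - k) • J (H g) + J g := by
  obtain ⟨hd, hh⟩ := hH.1 g
  have h1 := hJ.2 ⟨H g, hd⟩
  have h2 : l • H g - T ⟨H g, hd⟩ = (l - k) • H g + g := by
    have e : T ⟨H g, hd⟩ = k • H g - g := by rw [sub_eq_iff_eq_add.1 hh]; abel
    rw [e, sub_smul]; abel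
  simp only [h2, map_add, map_smul] at h1
  exact h1.symm

/-- For `l ≠ k`, the resolvent identity read in both orders shows that `(l - k) J H` and `(l - k) H
J` both equal `H - J`; for `l = k` it gives `J = H`. -/
theorem IsResolvent.commute {T : E →ₗ.[ℝ] E} {l k : ℝ} {J H : E →L[ℝ] E}
    (hJ : IsResolvent T l J) (hH : IsResolvent T k H) : Commute J H := by
  ext g
  rw [mul_apply_eq_comp, mul_apply_eq_comp]
  have h1 := hJ.resolvent_identity hH g
  have h2 := hH.resolvent_identity hJ g
  rcases eq_or_ne l k with rfl | hlk
  · simp only [sub_self, zero_smul, zero_add] at h1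
    have h3 := hJ.resolvent_identity hH (H g)
    have h4 := hJ.resolvent_identity hH (J g)
    simp only [sub_self, zero_smul, zero_add] at h3 h4
    rw [← h3, h1, h4]
  · have h3 : (l - k) • J (H g) = (l - k) • H (J g) := by
      have e1 : (l - k) • J (H g) = H g - J g := by
        nth_rewrite 2 [h1]; abel
      have e2 : (l - k) • H (J g) = H g - J g := by
        nth_rewrite 2 [h2]; rw [sub_smul, sub_smul]; abel
      rw [e1, e2]
    exact smul_right_injective E (sub_ne_zero.2 hlk) h3

theorem commute_yosidaApprox {J H : E →L[ℝ] E} (h : Commute J H) (l k : ℝ) :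
    Commute (yosidaApprox l J) (yosidaApprox k H) := by
  unfold yosidaApprox
  refine Commute.sub_left (Commute.sub_right ?_ ?_) (Commute.sub_right ?_ ?_)
  · exact (h.smul_left _).smul_right _
  · exact ((Commute.one_right J).smul_left _).smul_right _
  · exact ((Commute.one_left H).smul_left _).smul_right _
  · exact ((Commute.refl _).smul_left _).smul_right _

theorem IsResolvent.smul_sub_self {T : E →ₗ.[ℝ] E} {l : ℝ} {J : E →L[ℝ] E}
    (hJ : IsResolvent T l J) (f : T.domain) : l • J f - f = J (T f) := by
  have := hJ.2 f
  rw [map_sub, map_smul] at this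
  nth_rewrite 2 [← this]
  abel

/-- Convergence of the Yosida approximations to `T` on the domain is thereby reduced to `l J → 1`
strongly. -/
theorem IsResolvent.yosidaApprox_apply {T : E →ₗ.[ℝ] E} {l : ℝ} {J : E →L[ℝ] E}
    (hJ : IsResolvent T l J) (f : T.domain) : yosidaApprox l J f = l • J (T f) := by
  rw [← hJ.smul_sub_self f]
  simp [yosidaApprox, smul_sub, smul_smul, sq]

/-- On the domain `k J f - f = J (T f)` is of order `1 / (k - w)`. Density does the rest, since `k ≥
2 w` gives `k / (k - w) ≤ 2` and hence a uniform bound on `k J`. -/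
theorem tendsto_smul_resolvent {T : E →ₗ.[ℝ] E} (hT : Dense (T.domain : Set E)) {w : ℝ}
    {k : ℕ → ℝ} (hk : Tendsto k atTop atTop) (hkw : ∀ n, w < k n) (hk2 : ∀ n, 2 * w ≤ k n)
    {J : ℕ → E →L[ℝ] E} (hJ : ∀ n, IsResolvent T (k n) (J n))
    (hnorm : ∀ n g, ‖J n g‖ ≤ 1 / (k n - w) * ‖g‖) (hk0 : ∀ n, 0 < k n) (f : E) :
    Tendsto (fun n => k n • J n f) atTop (𝓝 f) := by
  have hb : ∀ n g, ‖k n • J n g‖ ≤ 2 * ‖g‖ := by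
    intro n g
    rw [norm_smul, Real.norm_of_nonneg (hk0 n).le]
    calc k n * ‖J n g‖ ≤ k n * (1 / (k n - w) * ‖g‖) :=
          mul_le_mul_of_nonneg_left (hnorm n g) (hk0 n).le
      _ = k n / (k n - w) * ‖g‖ := by ring
      _ ≤ 2 * ‖g‖ := by
        refine mul_le_mul_of_nonneg_right ?_ (norm_nonneg _)
        rw [div_le_iff₀ (sub_pos.2 (hkw n))]
        linarith [hk2 n]
  rw [Metric.tendsto_atTop]
  intro ε hε
  obtain ⟨g, hgD, hg⟩ := hT.exists_dist_lt f (ε := ε / 4) (by positivity)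
  have h1 : Tendsto (fun n => 1 / (k n - w) * ‖T ⟨g, hgD⟩‖) atTop (𝓝 0) := by
    have h2 : Tendsto (fun n => k n - w) atTop atTop := tendsto_atTop_add_const_right _ (-w) hk
    simpa [one_div] using (tendsto_inv_atTop_zero.comp h2).mul_const ‖T ⟨g, hgD⟩‖
  obtain ⟨N, hN⟩ := (h1.eventually (gt_mem_nhds
    (show (0 : ℝ) < ε / 4 by positivity))).exists_forall_of_atTop
  refine ⟨N, fun n hn => ?_⟩
  have e1 : ‖k n • J n g - g‖ < ε / 4 := by
    have := (hJ n).smul_sub_self ⟨g, hgD⟩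
    simp only at this
    rw [this]
    exact (hnorm n _).trans_lt (hN n hn)
  rw [dist_eq_norm] at hg ⊢
  have e2 : k n • J n f - f = k n • J n (f - g) + (k n • J n g - g) - (f - g) := by
    rw [map_sub, smul_sub]; abel
  rw [e2]
  have e3 := norm_sub_le (k n • J n (f - g) + (k n • J n g - g)) (f - g)
  have e4 := norm_add_le (k n • J n (f - g)) (k n • J n g - g)
  have e5 := hb n (f - g)
  linarith

variable [CompleteSpace E]

/-- Splitting off the scalar part leaves a power series in `J` with nonnegative coefficients, from
which both the norm bound and the invariance of cones are read. -/
theorem exp_smul_yosidaApprox (l t : ℝ) (J : E →L[ℝ] E) :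
    exp (t • yosidaApprox l J) = Real.exp (-(l * t)) • exp ((t * l ^ 2) • J) := by
  let _ : NormedAlgebra ℚ (E →L[ℝ] E) := NormedAlgebra.restrictScalars ℚ ℝ _
  have h1 : t • yosidaApprox l J = (-(l * t)) • (1 : E →L[ℝ] E) + (t * l ^ 2) • J := by
    rw [yosidaApprox, smul_sub, smul_smul, smul_smul, neg_smul, mul_comm t l]; abel
  rw [h1, exp_add_of_commute (((Commute.one_left J).smul_left _).smul_right _)]
  have h2 : exp ((-(l * t)) • (1 : E →L[ℝ] E)) = Real.exp (-(l * t)) • 1 := by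
    rw [← Algebra.algebraMap_eq_smul_one, ← Algebra.algebraMap_eq_smul_one, Real.exp_eq_exp_ℝ,
      algebraMap_exp_comm]
  rw [h2, smul_mul_assoc, one_mul]

theorem norm_exp_smul_yosidaApprox_le {w l : ℝ} (hwl : w < l) {J : E →L[ℝ] E}
    (hJ : ∀ g, ‖J g‖ ≤ 1 / (l - w) * ‖g‖) {t : ℝ} (ht : 0 ≤ t) :
    ‖exp (t • yosidaApprox l J)‖ ≤ Real.exp (l * w / (l - w) * t) := by
  have hlw : 0 < l - w := sub_pos.2 hwl
  rw [exp_smul_yosidaApprox, norm_smul, Real.norm_of_nonneg (Real.exp_nonneg _)]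
  have h1 : ‖(t * l ^ 2) • J‖ ≤ t * l ^ 2 * (1 / (l - w)) := by
    rw [norm_smul, Real.norm_of_nonneg (by positivity)]
    exact mul_le_mul_of_nonneg_left (J.opNorm_le_bound (by positivity) hJ) (by positivity)
  calc _ ≤ Real.exp (-(l * t)) * Real.exp (t * l ^ 2 * (1 / (l - w))) := by
        gcongr
        exact (norm_exp_le_exp_norm _).trans (Real.exp_le_exp.2 h1)
    _ = Real.exp (l * w / (l - w) * t) := by
        rw [← Real.exp_add]
        congr 1
        field_simp
        ring

/-- The partial sums of the exponential series are nonnegative combinations of powers of `J` applied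
to `f`, and the cone is closed. -/
theorem exp_smul_yosidaApprox_mem {C : Set E} (hC : IsClosed C) (hC0 : (0 : E) ∈ C)
    (hadd : ∀ f ∈ C, ∀ g ∈ C, f + g ∈ C) (hsmul : ∀ c : ℝ, 0 ≤ c → ∀ f ∈ C, c • f ∈ C)
    {J : E →L[ℝ] E} (hJ : MapsTo J C C) (l : ℝ) {t : ℝ} (ht : 0 ≤ t) :
    MapsTo (exp (t • yosidaApprox l J) : E →L[ℝ] E) C C := by
  intro f hf
  rw [exp_smul_yosidaApprox]
  refine hsmul _ (Real.exp_nonneg _) _ ?_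
  set B := (t * l ^ 2) • J with hB
  have hBC : ∀ n : ℕ, (B ^ n) f ∈ C := by
    intro n
    induction n with
    | zero => simpa using hf
    | succ n ih =>
      rw [pow_succ', mul_apply_eq_comp]
      exact hsmul _ (by positivity) _ (hJ ih)
  have h1 : HasSum (fun n : ℕ => ((n.factorial : ℝ)⁻¹ • B ^ n) f) (exp B f) :=
    (exp_series_hasSum_exp' (𝕂 := ℝ) B).mapL (ContinuousLinearMap.apply ℝ E f)
  refine hC.mem_of_tendsto h1 (Eventually.of_forall fun s => ?_)
  exact Finset.sum_induction _ (· ∈ C) (fun a b ha hb => hadd a ha b hb) hC0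
    fun n _ => hsmul _ (by positivity) _ (hBC n)

/-- The **Hille–Yosida theorem** for quasi-contractive semigroups. The semigroup leaves invariant
every closed convex cone that the resolvents leave invariant. -/
theorem hilleYosida {T : E →ₗ.[ℝ] E} (hT : Dense (T.domain : Set E)) {w : ℝ} (hw : 0 ≤ w)
    {J : ℝ → E →L[ℝ] E} (hJ : ∀ l, w < l → IsResolvent T l (J l))
    (hnorm : ∀ l, w < l → ∀ g, ‖J l g‖ ≤ 1 / (l - w) * ‖g‖) :
    ∃ S : ℝ → E →L[ℝ] E, IsC0Semigroup S ∧ IsGeneratorOf T S ∧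
      (∀ t : ℝ, 0 ≤ t → ∀ f, ‖S t f‖ ≤ Real.exp (w * t) * ‖f‖) ∧
      ∀ C : Set E, IsClosed C → (0 : E) ∈ C → (∀ f ∈ C, ∀ g ∈ C, f + g ∈ C) →
        (∀ c : ℝ, 0 ≤ c → ∀ f ∈ C, c • f ∈ C) → (∀ l, w < l → MapsTo (J l) C C) →
        ∀ t : ℝ, 0 ≤ t → MapsTo (S t) C C := by
  -- The shift `2 w + 1` puts every `k n` above `w` and keeps the growth rates `k w / (k - w)` at
  -- most `2 w`.
  set k : ℕ → ℝ := fun n => n + (2 * w + 1) with hk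
  have hk2 : ∀ n, 2 * w + 1 ≤ k n := fun n => by simp [hk]
  have hkw : ∀ n, w < k n := fun n => by linarith [hk2 n]
  have hktop : Tendsto k atTop atTop :=
    tendsto_atTop_add_const_right _ _ tendsto_natCast_atTop_atTop
  set v : ℕ → ℝ := fun n => k n * w / (k n - w) with hv
  have hv2 : ∀ n, v n ≤ 2 * w := fun n => by
    rw [hv]
    simp only
    rw [div_le_iff₀ (sub_pos.2 (hkw n))]
    nlinarith [hk2 n]
  have hvw : Tendsto v atTop (𝓝 w) := by
    have h2 : Tendsto (fun n => k n - w) atTop atTop := tendsto_atTop_add_const_right _ (-w) hktop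
    -- Here `k w / (k - w) = w + w ^ 2 / (k - w)`.
    have h3 := ((tendsto_inv_atTop_zero.comp h2).const_mul (w ^ 2)).const_add w
    rw [mul_zero, add_zero] at h3
    refine h3.congr fun n => ?_
    have : k n - w ≠ 0 := (sub_pos.2 (hkw n)).ne'
    simp only [hv, Function.comp_apply]
    field_simp
    ring
  obtain ⟨S, h1, h2, h3, h4⟩ := exists_semigroup_of_bounded_approx
    (A := fun n => yosidaApprox (k n) (J (k n)))
    (fun i j => commute_yosidaApprox ((hJ _ (hkw i)).commute (hJ _ (hkw j))) _ _)
    (K := 2 * w) (by positivity) hv2 hvw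
    (fun n t ht => norm_exp_smul_yosidaApprox_le (hkw n) (hnorm _ (hkw n)) ht) hT
    (fun f => by
      simp only [(hJ _ (hkw _)).yosidaApprox_apply f]
      exact tendsto_smul_resolvent hT hktop hkw (fun n => by linarith [hk2 n])
        (fun n => hJ _ (hkw n)) (fun n => hnorm _ (hkw n)) (fun n => by linarith [hk2 n]) _)
    (lt_add_one w) (hJ _ (lt_add_one w))
  refine ⟨S, h1, h2, h3, fun C hC hC0 hadd hsmul hJC t ht f hf => ?_⟩
  exact hC.mem_of_tendsto (h4 t ht f) (Eventually.of_forall fun n =>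
    exp_smul_yosidaApprox_mem hC hC0 hadd hsmul (hJC _ (hkw n)) _ ht hf)

end HilleYosida

/-! ### Locally absolutely continuous functions on the half-line. -/

theorem ae_Ioi_of_forall_Icc {p : ℝ → Prop}
    (h : ∀ α β : ℝ, 0 < α → α ≤ β → ∀ᵐ x : ℝ, x ∈ Icc α β → p x) :
    ∀ᵐ x ∂(volume.restrict (Ioi (0 : ℝ))), p x := by
  rw [ae_restrict_iff' measurableSet_Ioi]
  have key : ∀ n : ℕ, ∀ᵐ x : ℝ, x ∈ Icc (1 / ((n : ℝ) + 1)) ((n : ℝ) + 1) → p x := by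
    intro n
    have hn : (0 : ℝ) < (n : ℝ) + 1 := by positivity
    have hle : 1 / ((n : ℝ) + 1) ≤ (n : ℝ) + 1 := by
      rw [div_le_iff₀ hn]
      nlinarith [(Nat.cast_nonneg n : (0 : ℝ) ≤ n)]
    exact h _ _ (by positivity) hle
  filter_upwards [ae_all_iff.2 key] with x hx hx0
  have hx0' : (0 : ℝ) < x := hx0
  obtain ⟨n₁, h₁⟩ := exists_nat_one_div_lt hx0'
  obtain ⟨n₂, h₂⟩ := exists_nat_gt x
  have hm1 : (n₁ : ℝ) ≤ (max n₁ n₂ : ℕ) := by exact_mod_cast le_max_left n₁ n₂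
  have hm2 : (n₂ : ℝ) ≤ (max n₁ n₂ : ℕ) := by exact_mod_cast le_max_right n₁ n₂
  refine hx (max n₁ n₂) ⟨?_, by linarith⟩
  refine le_trans (one_div_le_one_div_of_le (by positivity) ?_) h₁.le
  linarith

theorem ae_restrict_of_ae_Ioi {p : ℝ → Prop} {s : Set ℝ} (hs : s ⊆ Ioi 0)
    (h : ∀ᵐ x ∂(volume.restrict (Ioi (0 : ℝ))), p x) : ∀ᵐ x ∂(volume.restrict s), p x :=
  ae_restrict_of_ae_restrict_of_subset hs h

section LocAC

/-- The enlarged interval must contain the base point. This form serves `c = 1`, where `k` is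
integrable only away from `0`, as well as `c = 0`. -/
theorem isLocAC_integral {k : ℝ → ℝ} {c : ℝ}
    (h : ∀ α β : ℝ, 0 < α → α ≤ β → ∃ α' β', c ∈ uIcc α' β' ∧ Icc α β ⊆ uIcc α' β' ∧
      IntervalIntegrable k volume α' β') : IsLocAC fun x => ∫ t in c..x, k t := by
  intro α β hα hαβ
  obtain ⟨α', β', hc, hsub, hint⟩ := h α β hα hαβ
  refine (hint.absolutelyContinuousOnInterval_intervalIntegral hc).mono ?_
  rwa [uIcc_of_le hαβ]

theorem ae_hasDerivAt_integral {k : ℝ → ℝ} {c : ℝ}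
    (h : ∀ α β : ℝ, 0 < α → α ≤ β → ∃ α' β', c ∈ uIcc α' β' ∧ Icc α β ⊆ uIcc α' β' ∧
      IntervalIntegrable k volume α' β') :
    ∀ᵐ x ∂(volume.restrict (Ioi (0 : ℝ))), HasDerivAt (fun x => ∫ t in c..x, k t) (k x) x := by
  refine ae_Ioi_of_forall_Icc fun α β hα hαβ => ?_
  obtain ⟨α', β', hc, hsub, hint⟩ := h α β hα hαβ
  filter_upwards [hint.ae_hasDerivAt_integral] with x hx hxm
  exact hx (hsub hxm) c hc

theorem exists_Icc_of_one {k : ℝ → ℝ}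
    (h : ∀ α β : ℝ, 0 < α → α ≤ β → IntervalIntegrable k volume α β) (α β : ℝ) (hα : 0 < α)
    (_ : α ≤ β) : ∃ α' β', (1 : ℝ) ∈ uIcc α' β' ∧ Icc α β ⊆ uIcc α' β' ∧
      IntervalIntegrable k volume α' β' := by
  have hle : min α 1 ≤ max β 1 := (min_le_right _ _).trans (le_max_right _ _)
  refine ⟨min α 1, max β 1, ?_, ?_, h _ _ (by positivity) hle⟩
  · rw [uIcc_of_le hle]
    exact ⟨min_le_right _ _, le_max_right _ _⟩
  · rw [uIcc_of_le hle]
    exact Icc_subset_Icc (min_le_left _ _) (le_max_left _ _)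

theorem exists_Icc_of_zero {k : ℝ → ℝ} (h : ∀ x : ℝ, 0 < x → IntegrableOn k (Ioc 0 x))
    (α β : ℝ) (hα : 0 < α)
    (hαβ : α ≤ β) : ∃ α' β', (0 : ℝ) ∈ uIcc α' β' ∧ Icc α β ⊆ uIcc α' β' ∧
      IntervalIntegrable k volume α' β' := by
  have hβ : 0 < β := hα.trans_le hαβ
  refine ⟨0, β, left_mem_uIcc, ?_, ?_⟩
  · rw [uIcc_of_le hβ.le]
    exact Icc_subset_Icc_left hα.le
  · exact (intervalIntegrable_iff_integrableOn_Ioc_of_le hβ.le).2 (h β hβ)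

theorem tendsto_integral_zero {k : ℝ → ℝ} (h : ∀ x : ℝ, 0 < x → IntegrableOn k (Ioc 0 x)) :
    Tendsto (fun x => ∫ t in (0 : ℝ)..x, k t) (𝓝[>] 0) (𝓝 0) := by
  have h1 : IntervalIntegrable k volume 0 1 :=
    (intervalIntegrable_iff_integrableOn_Ioc_of_le zero_le_one).2 (h 1 one_pos)
  have h2 := intervalIntegral.continuousOn_primitive_interval' h1 left_mem_uIcc 0 left_mem_uIcc
  rw [uIcc_of_le zero_le_one] at h2
  have h3 := h2.tendsto.mono_left (nhdsWithin_le_of_mem (Icc_mem_nhdsGT one_pos))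
  simpa using h3

theorem IsLocAC.mul {φ ψ : ℝ → ℝ} (hφ : IsLocAC φ) (hψ : IsLocAC ψ) :
    IsLocAC fun x => φ x * ψ x := fun α β h₀ h₁ => (hφ α β h₀ h₁).mul (hψ α β h₀ h₁)

/-- On a compact interval `φ` is bounded, and `exp` is Lipschitz on its range. -/
theorem IsLocAC.exp {φ : ℝ → ℝ} (hφ : IsLocAC φ) : IsLocAC fun x => Real.exp (φ x) := by
  intro α β h₀ h₁
  have h := hφ α β h₀ h₁
  obtain ⟨C, hC⟩ := h.exists_bound
  obtain ⟨K, hK⟩ := (Real.contDiff_exp (n := 1)).contDiffOn.exists_lipschitzOnWith (by decide)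
    (convex_Icc (-C) C) isCompact_Icc
  have hmem : ∀ x ∈ uIcc α β, φ x ∈ Icc (-C) C := fun x hx => abs_le.1 (hC x hx)
  refine squeeze_zero' (Eventually.of_forall fun E => Finset.sum_nonneg fun _ _ => dist_nonneg) ?_
    (by simpa using Tendsto.const_mul (K : ℝ) h)
  filter_upwards [mem_inf_of_right (mem_principal_self _)] with E hE
  rw [Finset.mul_sum]
  refine Finset.sum_le_sum fun i hi => ?_
  exact hK.dist_le_mul _ (hmem _ (hE.1 i hi).1) _ (hmem _ (hE.1 i hi).2)

theorem isLocAC_of_contDiffOn {φ : ℝ → ℝ} (hφ : ContDiffOn ℝ 1 φ (Ioi 0)) : IsLocAC φ := by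
  intro α β h₀ h₁
  refine (hφ.mono ?_).absolutelyContinuousOnInterval
  rw [uIcc_of_le h₁]
  exact fun x hx => h₀.trans_le hx.1

end LocAC

/-! ### Coefficients and the exponent `l R + Q`. -/

/-- The properties of the growth rate `r` and the absorption rate `q` used for the transport
operator. -/
structure Admissible (r q : ℝ → ℝ) (ρ : ℝ) : Prop where
  inv_loc : LocallyIntegrableOn (fun x => 1 / r x) (Ioi (0 : ℝ))
  pos : ∀ᵐ x ∂(volume.restrict (Ioi (0 : ℝ))), 0 < r x
  le : ∀ᵐ x ∂(volume.restrict (Ioi (0 : ℝ))), r x ≤ ρ * (1 + x)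
  nonneg : ∀ᵐ x ∂(volume.restrict (Ioi (0 : ℝ))), 0 ≤ q x
  loc : MemLinftyLoc q

/-- The exponent `l R(x) + Q(x)`. -/
noncomputable def exponent (r q : ℝ → ℝ) (l x : ℝ) : ℝ := l * antideriv 1 r x + antideriv q r x

namespace Admissible

variable {r q : ℝ → ℝ} {ρ : ℝ}

theorem rho_nonneg (H : Admissible r q ρ) : 0 ≤ ρ := by
  have : ∀ᵐ x ∂(volume.restrict (Ioi (0 : ℝ))), 0 ≤ ρ := by
    filter_upwards [H.pos, H.le, ae_restrict_mem measurableSet_Ioi] with x h1 h2 h3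
    have h3' : (0 : ℝ) < x := h3
    by_contra h
    nlinarith
  have hne : (volume.restrict (Ioi (0 : ℝ))) ≠ 0 := by
    rw [Ne, Measure.restrict_eq_zero]; simp
  have : NeBot (ae (volume.restrict (Ioi (0 : ℝ)))) := ae_neBot.2 hne
  exact eventually_const.1 ‹∀ᵐ x ∂(volume.restrict (Ioi (0 : ℝ))), 0 ≤ ρ›

/-- Measurability of `r` is inherited from `1 / r`, whose pointwise inverse it is; the convention
`0⁻¹ = 0` covers zeros. -/
theorem aemeasurable_r (H : Admissible r q ρ) :
    AEStronglyMeasurable r (volume.restrict (Ioi 0)) := by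
  have h := H.inv_loc.aestronglyMeasurable
  have h2 := (h.aemeasurable.inv).aestronglyMeasurable
  refine h2.congr (Eventually.of_forall fun x => ?_)
  simp

theorem aemeasurable_q (H : Admissible r q ρ) :
    AEStronglyMeasurable q (volume.restrict (Ioi 0)) := by
  have : Ioi (0 : ℝ) = ⋃ n : ℕ, Ioc (0 : ℝ) n := by
    ext x
    simp only [mem_Ioi, mem_iUnion, mem_Ioc]
    exact ⟨fun h => (exists_nat_ge x).imp fun n hn => ⟨h, hn⟩, fun ⟨_, h⟩ => h.1⟩
  rw [this, aestronglyMeasurable_iUnion_iff]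
  exact fun n => (H.loc n).aestronglyMeasurable

theorem intervalIntegrable_inv (H : Admissible r q ρ) {α β : ℝ} (hα : 0 < α) (hαβ : α ≤ β) :
    IntervalIntegrable (fun x => 1 / r x) volume α β := by
  rw [intervalIntegrable_iff_integrableOn_Icc_of_le hαβ]
  exact H.inv_loc.integrableOn_compact_subset (fun x hx => hα.trans_le hx.1) isCompact_Icc

theorem intervalIntegrable_div (H : Admissible r q ρ) {α β : ℝ} (hα : 0 < α) (hαβ : α ≤ β) :
    IntervalIntegrable (fun x => q x / r x) volume α β := by
  have h1 := H.intervalIntegrable_inv hα hαβ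
  rw [intervalIntegrable_iff_integrableOn_Ioc_of_le hαβ] at h1 ⊢
  have h2 : MemLp q ⊤ (volume.restrict (Ioc α β)) :=
    (H.loc β).mono_measure (Measure.restrict_mono (Ioc_subset_Ioc_left hα.le) le_rfl)
  have h3 : Integrable (fun x => q x * (1 / r x)) (volume.restrict (Ioc α β)) :=
    h1.mul_of_top_right h2
  exact h3.congr (Eventually.of_forall fun x => by simp [div_eq_mul_inv])

theorem isLocAC_antideriv_one (H : Admissible r q ρ) : IsLocAC (antideriv 1 r) :=
  isLocAC_integral (exists_Icc_of_one fun _ _ => H.intervalIntegrable_inv)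

theorem isLocAC_antideriv (H : Admissible r q ρ) : IsLocAC (antideriv q r) :=
  isLocAC_integral (exists_Icc_of_one fun _ _ => H.intervalIntegrable_div)

theorem isLocAC_exponent (H : Admissible r q ρ) (l : ℝ) : IsLocAC (exponent r q l) :=
  fun α β h₀ h₁ => ((H.isLocAC_antideriv_one α β h₀ h₁).const_mul l).add
    (H.isLocAC_antideriv α β h₀ h₁)

theorem ae_hasDerivAt_exponent (H : Admissible r q ρ) (l : ℝ) :
    ∀ᵐ x ∂(volume.restrict (Ioi (0 : ℝ))),
      HasDerivAt (exponent r q l) ((l + q x) / r x) x := by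
  have h1 := ae_hasDerivAt_integral (exists_Icc_of_one fun _ _ => H.intervalIntegrable_inv)
  have h2 := ae_hasDerivAt_integral (exists_Icc_of_one fun _ _ => H.intervalIntegrable_div)
  filter_upwards [h1, h2] with x hx1 hx2
  refine ((hx1.const_mul l).add hx2).congr_deriv ?_
  ring

theorem monotoneOn_antideriv {h : ℝ → ℝ} (hr : ∀ᵐ x ∂(volume.restrict (Ioi (0 : ℝ))), 0 ≤ h x / r x)
    (hint : ∀ α β : ℝ, 0 < α → α ≤ β → IntervalIntegrable (fun x => h x / r x) volume α β) :
    MonotoneOn (antideriv h r) (Ioi 0) := by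
  have hi : ∀ x y : ℝ, 0 < x → 0 < y → IntervalIntegrable (fun x => h x / r x) volume x y := by
    intro x y hx hy
    rcases le_total x y with hxy | hxy
    · exact hint x y hx hxy
    · exact (hint y x hy hxy).symm
  intro x hx y hy hxy
  rw [antideriv, antideriv, ← sub_nonneg,
    intervalIntegral.integral_interval_sub_left (hi 1 y one_pos hy) (hi 1 x one_pos hx)]
  refine intervalIntegral.integral_nonneg_of_ae_restrict hxy ?_
  exact ae_restrict_of_ae_Ioi (fun z hz => lt_of_lt_of_le hx hz.1) hr

theorem monotoneOn_exponent (H : Admissible r q ρ) {l : ℝ} (hl : 0 ≤ l) :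
    MonotoneOn (exponent r q l) (Ioi 0) := by
  have h1 : MonotoneOn (antideriv 1 r) (Ioi 0) := by
    refine monotoneOn_antideriv ?_ fun _ _ => H.intervalIntegrable_inv
    filter_upwards [H.pos] with x hx
    simpa using hx.le
  have h2 : MonotoneOn (antideriv q r) (Ioi 0) := by
    refine monotoneOn_antideriv ?_ fun _ _ => H.intervalIntegrable_div
    filter_upwards [H.pos, H.nonneg] with x hx hx2
    positivity
  exact fun x hx y hy hxy => add_le_add (mul_le_mul_of_nonneg_left (h1 hx hy hxy) hl) (h2 hx hy hxy)

end Admissible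

/-! ### The weight `1 + x ^ m`. -/

section Weight

variable {m : ℝ}

theorem one_le_weight {x : ℝ} (hx : 0 ≤ x) (m : ℝ) : 1 ≤ 1 + x ^ m := by
  have := Real.rpow_nonneg hx m
  linarith

theorem lintegral_weightMeasure (m : ℝ) (F : ℝ → ℝ≥0∞) :
    ∫⁻ x, F x ∂(weightMeasure m) = ∫⁻ x in Ioi (0 : ℝ), ENNReal.ofReal (1 + x ^ m) * F x :=
  lintegral_withDensity_eq_lintegral_mul_non_measurable _ (by fun_prop)
    (Eventually.of_forall fun _ => ENNReal.ofReal_lt_top) F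

theorem aestronglyMeasurable_weightMeasure_iff {f : ℝ → ℝ} :
    AEStronglyMeasurable f (weightMeasure m) ↔
      AEStronglyMeasurable f (volume.restrict (Ioi (0 : ℝ))) := by
  constructor
  · exact fun h => h.mono_ac (Measure.ae_le_iff_absolutelyContinuous.1 (ae_weightMeasure m).ge)
  · exact fun h => h.mono_ac (Measure.ae_le_iff_absolutelyContinuous.1 (ae_weightMeasure m).le)

theorem integrableOn_mul_weight {g : ℝ → ℝ} (hg : MemLp g 1 (weightMeasure m)) :
    IntegrableOn (fun x => |g x| * (1 + x ^ m)) (Ioi 0) := by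
  have hmeas := aestronglyMeasurable_weightMeasure_iff.1 hg.aestronglyMeasurable
  refine ⟨(hmeas.norm).mul (by fun_prop), ?_⟩
  have h1 := (memLp_one_iff_integrable.1 hg).hasFiniteIntegral
  rw [hasFiniteIntegral_iff_enorm, lintegral_weightMeasure] at h1
  refine (hasFiniteIntegral_iff_enorm.2 ((setLIntegral_mono' measurableSet_Ioi ?_).trans_lt h1))
  intro x hx
  rw [enorm_mul, mul_comm, Real.enorm_eq_ofReal_abs |g x|, abs_abs, ← Real.enorm_eq_ofReal_abs]
  gcongr
  rw [Real.enorm_of_nonneg (zero_le_one.trans (one_le_weight (le_of_lt hx) m))]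

theorem lintegral_enorm_weightMeasure {g : ℝ → ℝ} (hg : MemLp g 1 (weightMeasure m)) :
    ∫⁻ x, ‖g x‖ₑ ∂(weightMeasure m) =
      ENNReal.ofReal (∫ x in Ioi (0 : ℝ), |g x| * (1 + x ^ m)) := by
  rw [ofReal_integral_eq_lintegral_ofReal (integrableOn_mul_weight hg), lintegral_weightMeasure]
  · refine setLIntegral_congr_fun measurableSet_Ioi fun x _ => ?_
    rw [ENNReal.ofReal_mul (abs_nonneg _), mul_comm, Real.enorm_eq_ofReal_abs]
  · filter_upwards [ae_restrict_mem measurableSet_Ioi] with x hx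
    exact mul_nonneg (abs_nonneg _) (zero_le_one.trans (one_le_weight (le_of_lt hx) m))

theorem integrableOn_Ioi_of_memLp {g : ℝ → ℝ} (hg : MemLp g 1 (weightMeasure m)) :
    IntegrableOn g (Ioi 0) := by
  have hmeas := aestronglyMeasurable_weightMeasure_iff.1 hg.aestronglyMeasurable
  refine (integrableOn_mul_weight hg).mono' hmeas ?_
  filter_upwards [ae_restrict_mem measurableSet_Ioi] with x hx
  exact le_mul_of_one_le_right (abs_nonneg _) (one_le_weight (le_of_lt hx) m)

/-- This is the source of the factor `2` in the growth bound `2 m ρ`: one copy of the weight bounds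
`x ^ (m - 1)`, by comparison with `1` or `x ^ m` according to `x ≤ 1` or `x ≥ 1`; the other bounds
`x ^ m`. -/
theorem rpow_sub_one_mul_le {x : ℝ} (hx : 0 < x) (hm : 1 ≤ m) :
    x ^ (m - 1) * (1 + x) ≤ 2 * (1 + x ^ m) := by
  have h1 : x ^ m = x ^ (m - 1) * x := by
    rw [← Real.rpow_add_one hx.ne', sub_add_cancel]
  have h2 : x ^ (m - 1) ≤ 1 + x ^ m := by
    rcases le_total x 1 with h | h
    · exact (Real.rpow_le_one hx.le h (by linarith)).trans (one_le_weight hx.le m)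
    · have h3 : x ^ (m - 1) ≤ x ^ m := Real.rpow_le_rpow_of_exponent_le h (by linarith)
      linarith
  have h3 := Real.rpow_nonneg hx.le m
  nlinarith

theorem isLocAC_weight (m : ℝ) : IsLocAC fun x => 1 + x ^ m := by
  refine isLocAC_of_contDiffOn (contDiffOn_const.add fun x hx => ?_)
  exact (Real.contDiffAt_rpow_const_of_ne (ne_of_gt hx)).contDiffWithinAt

end Weight

/-! ### The resolvent formula and its energy estimate. -/

/-- The flux `r f` for `f = resolventFormula r q l g`. -/
noncomputable def flux (r q : ℝ → ℝ) (l : ℝ) (g : ℝ → ℝ) (x : ℝ) : ℝ :=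
  Real.exp (-exponent r q l x) * ∫ y in (0 : ℝ)..x, resolventIntegrand r q l g y

theorem resolventFormula_eq (r q : ℝ → ℝ) (l : ℝ) (g : ℝ → ℝ) (x : ℝ) :
    resolventFormula r q l g x = flux r q l g x / r x := by
  have : -l * antideriv 1 r x - antideriv q r x = -exponent r q l x := by
    rw [exponent]; ring
  rw [resolventFormula, flux, this]
  ring

namespace Admissible

variable {r q : ℝ → ℝ} {ρ l m : ℝ} {g : ℝ → ℝ}

/-- The exponent may tend to `-∞` at `0`, but it is monotone, so the exponential factor is bounded
on `(0, x]` by its value at `x`. -/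
theorem integrableOn_resolventIntegrand (H : Admissible r q ρ) (hl : 0 ≤ l)
    (hg : IntegrableOn g (Ioi 0)) {x : ℝ} (hx : 0 < x) :
    IntegrableOn (resolventIntegrand r q l g) (Ioc 0 x) := by
  have hg' : IntegrableOn g (Ioc 0 x) := hg.mono_set Ioc_subset_Ioi_self
  refine Integrable.bdd_mul (c := Real.exp (exponent r q l x)) hg' ?_ ?_
  · refine ContinuousOn.aestronglyMeasurable ?_ measurableSet_Ioc
    exact (H.isLocAC_exponent l).exp.continuousOn.mono Ioc_subset_Ioi_self
  · filter_upwards [ae_restrict_mem measurableSet_Ioc] with y hy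
    rw [Real.norm_of_nonneg (Real.exp_nonneg _)]
    exact Real.exp_le_exp.2 (H.monotoneOn_exponent hl hy.1 hx hy.2)

theorem isLocAC_neg_exponent (H : Admissible r q ρ) (l : ℝ) :
    IsLocAC fun x => Real.exp (-exponent r q l x) :=
  IsLocAC.exp fun α β h₀ h₁ => (H.isLocAC_exponent l α β h₀ h₁).neg

theorem isLocAC_flux (H : Admissible r q ρ) (hl : 0 ≤ l) (hg : IntegrableOn g (Ioi 0)) :
    IsLocAC (flux r q l g) :=
  (H.isLocAC_neg_exponent l).mul (isLocAC_integral (exists_Icc_of_zero fun _ =>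
    H.integrableOn_resolventIntegrand hl hg))

/-- This is the resolvent equation `(r f)' = g - (l + q) f`; the two exponentials cancel in the
product rule. -/
theorem ae_hasDerivAt_flux (H : Admissible r q ρ) (hl : 0 ≤ l) (hg : IntegrableOn g (Ioi 0)) :
    ∀ᵐ x ∂(volume.restrict (Ioi (0 : ℝ))),
      HasDerivAt (flux r q l g) (g x - (l + q x) * resolventFormula r q l g x) x := by
  have h1 := ae_hasDerivAt_integral (exists_Icc_of_zero fun _ =>
    H.integrableOn_resolventIntegrand hl hg)
  filter_upwards [h1, H.ae_hasDerivAt_exponent l] with x hx1 hx2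
  refine (hx2.neg.exp.mul hx1).congr_deriv ?_
  have : resolventIntegrand r q l g x = Real.exp (exponent r q l x) * g x := rfl
  rw [resolventFormula_eq, flux, this, ← mul_assoc, ← Real.exp_add, Pi.neg_apply,
    neg_add_cancel, Real.exp_zero]
  ring

/-- For `y ≤ x` monotonicity of the exponent makes the kernel at most `1`. The bound tends to `0`
with `x`, so the boundary condition holds whether or not `1 / r` is integrable at `0`. -/
theorem flux_le (H : Admissible r q ρ) (hl : 0 ≤ l) (hg : IntegrableOn g (Ioi 0)) {x : ℝ}
    (hx : 0 < x) : |flux r q l g x| ≤ ∫ y in (0 : ℝ)..x, |g y| := by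
  have h0 : IntervalIntegrable g volume 0 x :=
    (intervalIntegrable_iff_integrableOn_Ioc_of_le hx.le).2 (hg.mono_set Ioc_subset_Ioi_self)
  rw [flux, ← intervalIntegral.integral_const_mul]
  rw [← Real.norm_eq_abs]
  refine intervalIntegral.norm_integral_le_of_norm_le hx.le (Eventually.of_forall fun y hy => ?_)
    h0.abs
  have : resolventIntegrand r q l g y = Real.exp (exponent r q l y) * g y := rfl
  rw [this, ← mul_assoc, ← Real.exp_add, norm_mul, Real.norm_of_nonneg (Real.exp_nonneg _)]
  refine mul_le_of_le_one_left (abs_nonneg _) (Real.exp_le_one_iff.2 ?_)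
  linarith [H.monotoneOn_exponent hl hy.1 hx hy.2]

theorem tendsto_flux (H : Admissible r q ρ) (hl : 0 ≤ l) (hg : IntegrableOn g (Ioi 0)) :
    Tendsto (flux r q l g) (𝓝[>] 0) (𝓝 0) := by
  have h1 := tendsto_integral_zero (k := fun y => |g y|)
    fun x _ => (hg.mono_set Ioc_subset_Ioi_self).abs
  refine squeeze_zero_norm' ?_ h1
  filter_upwards [self_mem_nhdsWithin] with x hx using H.flux_le hl hg hx

theorem flux_nonneg (hg : ∀ᵐ x ∂(volume.restrict (Ioi (0 : ℝ))), 0 ≤ g x) {x : ℝ} (hx : 0 < x) :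
    0 ≤ flux r q l g x := by
  refine mul_nonneg (Real.exp_nonneg _) ?_
  rw [intervalIntegral.integral_of_le hx.le]
  refine integral_nonneg_of_ae ?_
  filter_upwards [ae_restrict_of_ae_Ioi Ioc_subset_Ioi_self hg] with y hy
  exact mul_nonneg (Real.exp_nonneg _) hy

theorem abs_flux_le {x : ℝ} (hx : 0 < x) :
    |flux r q l g x| ≤ flux r q l (fun y => |g y|) x := by
  rw [flux, flux, abs_mul, abs_of_nonneg (Real.exp_nonneg _)]
  refine mul_le_mul_of_nonneg_left ?_ (Real.exp_nonneg _)
  refine (intervalIntegral.abs_integral_le_integral_abs hx.le).trans_eq ?_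
  refine intervalIntegral.integral_congr fun y _ => ?_
  simp [resolventIntegrand, abs_mul]

/-- With `u` the resolvent and `w` the weight, `(r u w)' = g w - (l + q) u w + r u w'`. As `r w' ≤ 2
m ρ w`, the integrand is at most `g w - (r u w)'`. Integration leaves two boundary terms: the one at
`β` is dropped by its sign, the one at `α` is kept. -/
theorem lintegral_Ioc_le (H : Admissible r q ρ) (hm : 1 ≤ m) (hl : 2 * m * ρ < l)
    (hg : MemLp g 1 (weightMeasure m)) (hg0 : ∀ x, 0 ≤ g x) {α β : ℝ} (hα : 0 < α) (hαβ : α ≤ β) :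
    ∫⁻ x in Ioc α β, ENNReal.ofReal ((l - 2 * m * ρ + q x) * resolventFormula r q l g x *
        (1 + x ^ m)) ≤
      ENNReal.ofReal ((∫ x in Ioi (0 : ℝ), |g x| * (1 + x ^ m)) +
        flux r q l g α * (1 + α ^ m)) := by
  have hρ := H.rho_nonneg
  have hl0 : 0 ≤ l := by
    have : 0 ≤ 2 * m * ρ := by positivity
    linarith
  have hgi := integrableOn_Ioi_of_memLp hg
  set ψ : ℝ → ℝ := fun x => flux r q l g x * (1 + x ^ m) with hψ
  have hψac : AbsolutelyContinuousOnInterval ψ α β :=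
    ((H.isLocAC_flux hl0 hgi).mul (isLocAC_weight m)) α β hα hαβ
  have hsub : Ioc α β ⊆ Ioi 0 := fun x hx => hα.trans hx.1
  have hgw : IntegrableOn (fun x => |g x| * (1 + x ^ m)) (Ioc α β) :=
    (integrableOn_mul_weight hg).mono_set hsub
  have hψ' : IntegrableOn (deriv ψ) (Ioc α β) :=
    (intervalIntegrable_iff_integrableOn_Ioc_of_le hαβ).1 hψac.intervalIntegrable_deriv
  have hkey : ∀ᵐ x ∂(volume.restrict (Ioc α β)),
      0 ≤ (l - 2 * m * ρ + q x) * resolventFormula r q l g x * (1 + x ^ m) ∧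
      (l - 2 * m * ρ + q x) * resolventFormula r q l g x * (1 + x ^ m) ≤
        |g x| * (1 + x ^ m) - deriv ψ x := by
    refine ae_restrict_of_ae_Ioi hsub ?_
    filter_upwards [H.ae_hasDerivAt_flux hl0 hgi, H.pos, H.le, H.nonneg,
      ae_restrict_mem measurableSet_Ioi] with x h1 h2 h3 h4 h5
    have hx : (0 : ℝ) < x := h5
    have hw : HasDerivAt (fun x : ℝ => 1 + x ^ m) (m * x ^ (m - 1)) x :=
      (Real.hasDerivAt_rpow_const (Or.inl hx.ne')).const_add 1
    have hu : 0 ≤ resolventFormula r q l g x := by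
      rw [resolventFormula_eq]
      exact div_nonneg (flux_nonneg (Eventually.of_forall hg0) hx) h2.le
    have hflux : flux r q l g x = r x * resolventFormula r q l g x := by
      rw [resolventFormula_eq]; field_simp
    have hw1 := one_le_weight hx.le m
    refine ⟨mul_nonneg (mul_nonneg (by linarith) hu) (by linarith), ?_⟩
    have hd : deriv ψ x = _ := (h1.mul hw).deriv
    rw [hd, abs_of_nonneg (hg0 x), hflux]
    have h6 : r x * (m * x ^ (m - 1)) ≤ 2 * m * ρ * (1 + x ^ m) := by
      have h7 := rpow_sub_one_mul_le hx hm
      have h8 := Real.rpow_nonneg hx.le (m - 1)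
      calc r x * (m * x ^ (m - 1)) ≤ ρ * (1 + x) * (m * x ^ (m - 1)) := by gcongr
        _ = m * ρ * (x ^ (m - 1) * (1 + x)) := by ring
        _ ≤ m * ρ * (2 * (1 + x ^ m)) := by gcongr
        _ = _ := by ring
    nlinarith [mul_le_mul_of_nonneg_right h6 hu]
  calc _ ≤ ∫⁻ x in Ioc α β, ENNReal.ofReal (|g x| * (1 + x ^ m) - deriv ψ x) :=
        lintegral_mono_ae (hkey.mono fun x hx => ENNReal.ofReal_le_ofReal hx.2)
    _ = ENNReal.ofReal (∫ x in Ioc α β, (|g x| * (1 + x ^ m) - deriv ψ x)) :=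
        (ofReal_integral_eq_lintegral_ofReal (hgw.sub hψ')
          (hkey.mono fun x hx => hx.1.trans hx.2)).symm
    _ ≤ _ := by
        refine ENNReal.ofReal_le_ofReal ?_
        rw [integral_sub hgw hψ', ← intervalIntegral.integral_of_le hαβ (f := deriv ψ),
          hψac.integral_deriv_eq_sub]
        have h1 : ∫ x in Ioc α β, |g x| * (1 + x ^ m) ≤
            ∫ x in Ioi (0 : ℝ), |g x| * (1 + x ^ m) := by
          refine setIntegral_mono_set (integrableOn_mul_weight hg) ?_ hsub.eventuallyLE
          filter_upwards [ae_restrict_mem measurableSet_Ioi] with x hx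
          exact mul_nonneg (abs_nonneg _) (zero_le_one.trans (one_le_weight (le_of_lt hx) m))
        have h2 : 0 ≤ ψ β := mul_nonneg
          (flux_nonneg (Eventually.of_forall hg0) (hα.trans_le hαβ))
          (zero_le_one.trans (one_le_weight (hα.le.trans hαβ) m))
        simp only [hψ] at h2 ⊢
        linarith

theorem aestronglyMeasurable_resolventFormula (H : Admissible r q ρ) (hl : 0 ≤ l)
    (hg : IntegrableOn g (Ioi 0)) :
    AEStronglyMeasurable (resolventFormula r q l g) (volume.restrict (Ioi 0)) := by
  have h1 : AEStronglyMeasurable (flux r q l g) (volume.restrict (Ioi 0)) :=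
    (H.isLocAC_flux hl hg).continuousOn.aestronglyMeasurable measurableSet_Ioi
  refine (h1.mul H.aemeasurable_r.aemeasurable.inv.aestronglyMeasurable).congr
    (Eventually.of_forall fun x => ?_)
  simp [resolventFormula_eq, div_eq_mul_inv]

/-- The energy estimate: testing the resolvent equation with the weight. -/
theorem lintegral_resolventFormula_le (H : Admissible r q ρ) (hm : 1 ≤ m) (hl : 2 * m * ρ < l)
    (hg : MemLp g 1 (weightMeasure m)) :
    ∫⁻ x in Ioi (0 : ℝ), ENNReal.ofReal ((l - 2 * m * ρ + q x) *
        |resolventFormula r q l g x| * (1 + x ^ m)) ≤ ∫⁻ x, ‖g x‖ₑ ∂(weightMeasure m) := by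
  have hρ := H.rho_nonneg
  have hl0 : 0 ≤ l := by
    have : 0 ≤ 2 * m * ρ := by positivity
    linarith
  have hga : MemLp (fun y => |g y|) 1 (weightMeasure m) := hg.abs
  have hgi := integrableOn_Ioi_of_memLp hga
  set a : ℕ → ℝ := fun n => 1 / ((n : ℝ) + 1) with ha
  set b : ℕ → ℝ := fun n => (n : ℝ) + 1 with hb
  have ha0 : ∀ n, 0 < a n := fun n => by positivity
  have hab : ∀ n, a n ≤ b n := fun n => by
    have hn : (0 : ℝ) < (n : ℝ) + 1 := by positivity
    simp only [ha, hb]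
    rw [div_le_iff₀ hn]
    nlinarith [(Nat.cast_nonneg n : (0 : ℝ) ≤ n)]
  have halim : Tendsto a atTop (𝓝[>] 0) := tendsto_nhdsWithin_iff.2
    ⟨tendsto_one_div_add_atTop_nhds_zero_nat, Eventually.of_forall ha0⟩
  have hblim : Tendsto b atTop atTop :=
    tendsto_atTop_add_const_right _ _ tendsto_natCast_atTop_atTop
  have hcov : AECover (volume.restrict (Ioi (0 : ℝ))) atTop fun n => Ioc (a n) (b n) :=
    (aecover_Ioi_of_Ioi (tendsto_nhds_of_tendsto_nhdsWithin halim)).inter (aecover_Iic hblim)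
  set u := resolventFormula r q l fun y => |g y| with hu
  -- The resolvent is dominated by the resolvent of `|g|`, to which the estimate for nonnegative
  -- data applies.
  have hmono : ∫⁻ x in Ioi (0 : ℝ), ENNReal.ofReal ((l - 2 * m * ρ + q x) *
        |resolventFormula r q l g x| * (1 + x ^ m)) ≤
      ∫⁻ x in Ioi (0 : ℝ), ENNReal.ofReal ((l - 2 * m * ρ + q x) * u x * (1 + x ^ m)) := by
    refine lintegral_mono_ae ?_
    filter_upwards [H.pos, H.nonneg, ae_restrict_mem measurableSet_Ioi] with x h1 h2 h3
    have h4 : |resolventFormula r q l g x| ≤ u x := by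
      rw [hu, resolventFormula_eq, resolventFormula_eq, abs_div, abs_of_pos h1]
      have := abs_flux_le (r := r) (q := q) (l := l) (g := g) h3
      gcongr
    have h5 : 0 ≤ 1 + x ^ m := zero_le_one.trans (one_le_weight (le_of_lt h3) m)
    have h6 : 0 ≤ l - 2 * m * ρ + q x := by linarith
    gcongr
  refine hmono.trans ?_
  have hmeas : AEMeasurable (fun x => ENNReal.ofReal ((l - 2 * m * ρ + q x) * u x * (1 + x ^ m)))
      (volume.restrict (Ioi (0 : ℝ))) := by
    have h1 := H.aemeasurable_q.aemeasurable
    have h2 := (H.aestronglyMeasurable_resolventFormula hl0 hgi).aemeasurable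
    have h3 : AEMeasurable (fun x : ℝ => 1 + x ^ m) (volume.restrict (Ioi (0 : ℝ))) := by fun_prop
    exact (((h1.const_add _).mul h2).mul h3).ennreal_ofReal
  have hlim := hcov.lintegral_tendsto_of_countably_generated hmeas
  have hbd : ∀ n, ∫⁻ x in Ioc (a n) (b n), ENNReal.ofReal ((l - 2 * m * ρ + q x) * u x *
      (1 + x ^ m)) ∂(volume.restrict (Ioi (0 : ℝ))) ≤
      ENNReal.ofReal ((∫ x in Ioi (0 : ℝ), |g x| * (1 + x ^ m)) +
        flux r q l (fun y => |g y|) (a n) * (1 + (a n) ^ m)) := by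
    intro n
    rw [Measure.restrict_restrict measurableSet_Ioc,
      inter_eq_left.2 (show Ioc (a n) (b n) ⊆ Ioi 0 from fun x hx => (ha0 n).trans hx.1)]
    have := H.lintegral_Ioc_le hm hl hga (fun x => abs_nonneg _) (ha0 n) (hab n)
    simpa only [abs_abs] using this
  -- The boundary term vanishes at the left end because the flux tends to `0` there and the weight
  -- stays bounded.
  have hlim2 : Tendsto (fun n => ENNReal.ofReal ((∫ x in Ioi (0 : ℝ), |g x| * (1 + x ^ m)) +
        flux r q l (fun y => |g y|) (a n) * (1 + (a n) ^ m))) atTop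
      (𝓝 (ENNReal.ofReal ((∫ x in Ioi (0 : ℝ), |g x| * (1 + x ^ m)) + 0 * (1 + 0 ^ m)))) := by
    refine (ENNReal.continuous_ofReal.tendsto _).comp (Tendsto.const_add _ (Tendsto.mul ?_ ?_))
    · exact (H.tendsto_flux hl0 hgi).comp halim
    · refine Tendsto.const_add _ ?_
      exact ((Real.continuousAt_rpow_const 0 m (Or.inr (by linarith))).tendsto).comp
        (tendsto_nhds_of_tendsto_nhdsWithin halim)
  rw [zero_mul, add_zero, ← lintegral_enorm_weightMeasure hg] at hlim2
  exact le_of_tendsto_of_tendsto' hlim hlim2 hbd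

end Admissible

/-! ### The resolvent as a bounded positive two-sided inverse. -/

theorem ae_Ioi_of_ae_weightMeasure {m : ℝ} {p : ℝ → Prop} (h : ∀ᵐ x ∂(weightMeasure m), p x) :
    ∀ᵐ x ∂(volume.restrict (Ioi (0 : ℝ))), p x := by
  rwa [Filter.Eventually, ae_weightMeasure] at h

theorem ae_weightMeasure_of_ae_Ioi {m : ℝ} {p : ℝ → Prop}
    (h : ∀ᵐ x ∂(volume.restrict (Ioi (0 : ℝ))), p x) : ∀ᵐ x ∂(weightMeasure m), p x := by
  rwa [Filter.Eventually, ae_weightMeasure]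

theorem resolventFormula_congr {r q : ℝ → ℝ} {l : ℝ} {g h : ℝ → ℝ}
    (hgh : ∀ᵐ x ∂(volume.restrict (Ioi (0 : ℝ))), g x = h x) {x : ℝ} (hx : 0 < x) :
    resolventFormula r q l g x = resolventFormula r q l h x := by
  have : ∫ y in (0 : ℝ)..x, resolventIntegrand r q l g y =
      ∫ y in (0 : ℝ)..x, resolventIntegrand r q l h y := by
    rw [intervalIntegral.integral_of_le hx.le, intervalIntegral.integral_of_le hx.le]
    refine integral_congr_ae ?_
    filter_upwards [ae_restrict_of_ae_Ioi Ioc_subset_Ioi_self hgh] with y hy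
    simp only [resolventIntegrand, hy]
  simp only [resolventFormula, this]

theorem resolventFormula_const_mul (r q : ℝ → ℝ) (l c : ℝ) (g : ℝ → ℝ) (x : ℝ) :
    resolventFormula r q l (fun y => c * g y) x = c * resolventFormula r q l g x := by
  have : ∀ y, resolventIntegrand r q l (fun y => c * g y) y = c * resolventIntegrand r q l g y :=
    fun y => by simp only [resolventIntegrand]; ring
  simp only [resolventFormula, this, intervalIntegral.integral_const_mul]
  ring

namespace Admissible

variable {r q : ℝ → ℝ} {ρ l m : ℝ} {g h : ℝ → ℝ}

theorem resolventFormula_add (H : Admissible r q ρ) (hl : 0 ≤ l) (hg : IntegrableOn g (Ioi 0))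
    (hh : IntegrableOn h (Ioi 0)) {x : ℝ} (hx : 0 < x) :
    resolventFormula r q l (fun y => g y + h y) x =
      resolventFormula r q l g x + resolventFormula r q l h x := by
  have : ∀ y, resolventIntegrand r q l (fun y => g y + h y) y =
      resolventIntegrand r q l g y + resolventIntegrand r q l h y :=
    fun y => by simp only [resolventIntegrand]; ring
  have hi : ∀ k, IntegrableOn k (Ioi 0) →
      IntervalIntegrable (resolventIntegrand r q l k) volume 0 x := fun k hk =>
    (intervalIntegrable_iff_integrableOn_Ioc_of_le hx.le).2
      (H.integrableOn_resolventIntegrand hl hk hx)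
  simp only [resolventFormula, this, intervalIntegral.integral_add (hi g hg) (hi h hh)]
  ring

theorem nonneg_of_lt (H : Admissible r q ρ) (hm : 1 ≤ m) (hl : 2 * m * ρ < l) : 0 ≤ l := by
  have hρ := H.rho_nonneg
  have : 0 ≤ 2 * m * ρ := by positivity
  linarith

/-- The term with `q` is dropped from the energy estimate; keeping only that term gives the
absorption bound instead. -/
theorem ofReal_mul_lintegral_enorm_le (H : Admissible r q ρ) (hm : 1 ≤ m) (hl : 2 * m * ρ < l)
    (hg : MemLp g 1 (weightMeasure m)) :
    ENNReal.ofReal (l - 2 * m * ρ) * ∫⁻ x, ‖resolventFormula r q l g x‖ₑ ∂(weightMeasure m) ≤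
      ∫⁻ x, ‖g x‖ₑ ∂(weightMeasure m) := by
  refine le_trans ?_ (H.lintegral_resolventFormula_le hm hl hg)
  rw [lintegral_weightMeasure, ← lintegral_const_mul' _ _ ENNReal.ofReal_ne_top]
  refine lintegral_mono_ae ?_
  filter_upwards [H.nonneg, ae_restrict_mem measurableSet_Ioi] with x h1 h2
  have hw : 0 ≤ 1 + x ^ m := zero_le_one.trans (one_le_weight (le_of_lt h2) m)
  rw [Real.enorm_eq_ofReal_abs, ← ENNReal.ofReal_mul hw, ← ENNReal.ofReal_mul (by linarith)]
  refine ENNReal.ofReal_le_ofReal ?_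
  have : 0 ≤ q x * (|resolventFormula r q l g x| * (1 + x ^ m)) := by positivity
  nlinarith

theorem lintegral_enorm_absorption_le (H : Admissible r q ρ) (hm : 1 ≤ m) (hl : 2 * m * ρ < l)
    (hg : MemLp g 1 (weightMeasure m)) :
    ∫⁻ x, ‖q x * resolventFormula r q l g x‖ₑ ∂(weightMeasure m) ≤
      ∫⁻ x, ‖g x‖ₑ ∂(weightMeasure m) := by
  refine le_trans ?_ (H.lintegral_resolventFormula_le hm hl hg)
  rw [lintegral_weightMeasure]
  refine lintegral_mono_ae ?_
  filter_upwards [H.nonneg, ae_restrict_mem measurableSet_Ioi] with x h1 h2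
  have hw : 0 ≤ 1 + x ^ m := zero_le_one.trans (one_le_weight (le_of_lt h2) m)
  rw [Real.enorm_eq_ofReal_abs, ← ENNReal.ofReal_mul hw, abs_mul, abs_of_nonneg h1]
  refine ENNReal.ofReal_le_ofReal ?_
  have : 0 ≤ (l - 2 * m * ρ) * (|resolventFormula r q l g x| * (1 + x ^ m)) := by
    have : 0 ≤ l - 2 * m * ρ := by linarith
    positivity
  nlinarith

theorem memLp_resolventFormula (H : Admissible r q ρ) (hm : 1 ≤ m) (hl : 2 * m * ρ < l)
    (hg : MemLp g 1 (weightMeasure m)) :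
    MemLp (resolventFormula r q l g) 1 (weightMeasure m) := by
  refine ⟨aestronglyMeasurable_weightMeasure_iff.2 (H.aestronglyMeasurable_resolventFormula
    (H.nonneg_of_lt hm hl) (integrableOn_Ioi_of_memLp hg)), ?_⟩
  have h1 := H.ofReal_mul_lintegral_enorm_le hm hl hg
  have h2 := hg.2
  rw [eLpNorm_one_eq_lintegral_enorm] at h2 ⊢
  by_contra h3
  rw [not_lt, top_le_iff] at h3
  rw [h3, ENNReal.mul_top (by simpa using hl)] at h1
  exact absurd (top_le_iff.1 h1) h2.ne

theorem memLp_absorption (H : Admissible r q ρ) (hm : 1 ≤ m) (hl : 2 * m * ρ < l)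
    (hg : MemLp g 1 (weightMeasure m)) :
    MemLp (fun x => q x * resolventFormula r q l g x) 1 (weightMeasure m) := by
  refine ⟨aestronglyMeasurable_weightMeasure_iff.2 (H.aemeasurable_q.mul
    (H.aestronglyMeasurable_resolventFormula (H.nonneg_of_lt hm hl)
      (integrableOn_Ioi_of_memLp hg))), ?_⟩
  have h2 := hg.2
  rw [eLpNorm_one_eq_lintegral_enorm] at h2 ⊢
  exact (H.lintegral_enorm_absorption_le hm hl hg).trans_lt h2

/-- The resolvent of the transport operator. -/
noncomputable def resolvent (H : Admissible r q ρ) (hm : 1 ≤ m) (hl : 2 * m * ρ < l) :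
    X m →L[ℝ] X m :=
  LinearMap.mkContinuous
    { toFun := fun g => (H.memLp_resolventFormula hm hl (Lp.memLp g)).toLp _
      map_add' := fun g h => by
        rw [← MemLp.toLp_add]
        refine (MemLp.toLp_eq_toLp_iff _ _).2 (ae_weightMeasure_of_ae_Ioi ?_)
        filter_upwards [ae_restrict_mem measurableSet_Ioi] with x hx
        rw [resolventFormula_congr (ae_Ioi_of_ae_weightMeasure (Lp.coeFn_add g h)) hx]
        exact H.resolventFormula_add (H.nonneg_of_lt hm hl)
          (integrableOn_Ioi_of_memLp (Lp.memLp g)) (integrableOn_Ioi_of_memLp (Lp.memLp h)) hx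
      map_smul' := fun c g => by
        rw [RingHom.id_apply, ← MemLp.toLp_const_smul]
        refine (MemLp.toLp_eq_toLp_iff _ _).2 (ae_weightMeasure_of_ae_Ioi ?_)
        filter_upwards [ae_restrict_mem measurableSet_Ioi] with x hx
        rw [resolventFormula_congr (ae_Ioi_of_ae_weightMeasure (Lp.coeFn_smul c g)) hx]
        exact resolventFormula_const_mul r q l c g x }
    (1 / (l - 2 * m * ρ)) fun g => by
      have h1 := H.ofReal_mul_lintegral_enorm_le hm hl (Lp.memLp g)
      have h2 := H.memLp_resolventFormula hm hl (Lp.memLp g)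
      have hpos : 0 < l - 2 * m * ρ := sub_pos.2 hl
      change ‖h2.toLp _‖ ≤ _
      rw [Lp.norm_toLp, Lp.norm_def, eLpNorm_one_eq_lintegral_enorm,
        eLpNorm_one_eq_lintegral_enorm]
      have h3 := ENNReal.toReal_mono
        (by rw [← eLpNorm_one_eq_lintegral_enorm]; exact (Lp.memLp g).2.ne) h1
      rw [ENNReal.toReal_mul, ENNReal.toReal_ofReal hpos.le] at h3
      rw [one_div, ← div_eq_inv_mul, le_div_iff₀ hpos, mul_comm]
      exact h3

theorem resolvent_ae_eq (H : Admissible r q ρ) (hm : 1 ≤ m) (hl : 2 * m * ρ < l) (g : X m) :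
    ∀ᵐ x ∂(volume.restrict (Ioi (0 : ℝ))),
      H.resolvent hm hl g x = resolventFormula r q l g x :=
  ae_Ioi_of_ae_weightMeasure
    (MemLp.coeFn_toLp (H.memLp_resolventFormula hm hl (Lp.memLp g)))

theorem norm_resolvent_le (H : Admissible r q ρ) (hm : 1 ≤ m) (hl : 2 * m * ρ < l) (g : X m) :
    ‖H.resolvent hm hl g‖ ≤ 1 / (l - 2 * m * ρ) * ‖g‖ :=
  (ContinuousLinearMap.le_opNorm _ _).trans (mul_le_mul_of_nonneg_right
    (LinearMap.mkContinuous_norm_le _ (one_div_nonneg.2 (sub_pos.2 hl).le) _) (norm_nonneg _))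

theorem resolvent_nonneg (H : Admissible r q ρ) (hm : 1 ≤ m) (hl : 2 * m * ρ < l) {g : X m}
    (hg : 0 ≤ g) : 0 ≤ H.resolvent hm hl g := by
  rw [← Lp.coeFn_nonneg] at hg ⊢
  refine ae_weightMeasure_of_ae_Ioi ?_
  filter_upwards [H.resolvent_ae_eq hm hl g, H.pos, ae_restrict_mem measurableSet_Ioi]
    with x h1 h2 h3
  rw [h1, resolventFormula_eq]
  exact div_nonneg (flux_nonneg (ae_Ioi_of_ae_weightMeasure hg) h3) h2.le

theorem isDomainRep_resolvent (H : Admissible r q ρ) (hm : 1 ≤ m) (hl : 2 * m * ρ < l) (g : X m) :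
    IsDomainRep r q (H.resolvent hm hl g) (flux r q l g) where
  rep := by
    filter_upwards [H.resolvent_ae_eq hm hl g, H.pos] with x h1 h2
    rw [h1, resolventFormula_eq]
    field_simp
  ac := H.isLocAC_flux (H.nonneg_of_lt hm hl) (integrableOn_Ioi_of_memLp (Lp.memLp g))
  deriv_mem := by
    have h1 := ((Lp.memLp g).sub ((H.memLp_resolventFormula hm hl (Lp.memLp g)).const_mul l)).sub
      (H.memLp_absorption hm hl (Lp.memLp g))
    refine (memLp_congr_ae (ae_weightMeasure_of_ae_Ioi ?_)).2 h1
    filter_upwards [H.ae_hasDerivAt_flux (H.nonneg_of_lt hm hl)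
      (integrableOn_Ioi_of_memLp (Lp.memLp g))] with x hx
    rw [hx.deriv]
    simp only [Pi.sub_apply]
    ring
  absorption_mem := by
    refine (memLp_congr_ae (ae_weightMeasure_of_ae_Ioi ?_)).2
      (H.memLp_absorption hm hl (Lp.memLp g))
    filter_upwards [H.resolvent_ae_eq hm hl g] with x hx
    rw [hx]
  boundary := fun _ =>
    H.tendsto_flux (H.nonneg_of_lt hm hl) (integrableOn_Ioi_of_memLp (Lp.memLp g))

/-- A function of the domain is recovered from `l f - T f` by the resolvent formula. -/
theorem flux_eq_of_isDomainRep (H : Admissible r q ρ) (hl : 0 ≤ l) {f : X m} {φ : ℝ → ℝ}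
    (hφ : IsDomainRep r q f φ) (hg : IntegrableOn g (Ioi 0))
    (hgf : ∀ᵐ x ∂(volume.restrict (Ioi (0 : ℝ))), g x = l * f x + deriv φ x + q x * f x)
    {x : ℝ} (hx : 0 < x) : flux r q l g x = φ x := by
  set G : ℝ → ℝ := fun x => ∫ y in (0 : ℝ)..x, resolventIntegrand r q l g y with hG
  have hGi := fun x (hx : 0 < x) => H.integrableOn_resolventIntegrand hl hg hx
  set D : ℝ → ℝ := fun x => Real.exp (exponent r q l x) * φ x with hD
  have hDac : IsLocAC D := (H.isLocAC_exponent l).exp.mul hφ.ac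
  -- Multiplication by the integrating factor turns the equation into `D' = G'`.
  have hDderiv : ∀ᵐ x ∂(volume.restrict (Ioi (0 : ℝ))),
      deriv D x = resolventIntegrand r q l g x := by
    filter_upwards [hgf, hφ.rep, hφ.ac.ae_differentiableAt, H.ae_hasDerivAt_exponent l, H.pos]
      with x h1 h2 h3 h4 h5
    have h6 : deriv D x = _ := (h4.exp.mul h3.hasDerivAt).deriv
    have h7 : resolventIntegrand r q l g x = Real.exp (exponent r q l x) * g x := rfl
    rw [h6, h7, h1, h2]
    field_simp
    ring
  have hconst : ∀ α : ℝ, 0 < α → α ≤ x → D x - G x = D α - G α := by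
    intro α hα hαx
    have h1 := (hDac α x hα hαx).integral_deriv_eq_sub
    have h2 : ∫ y in α..x, deriv D y = ∫ y in α..x, resolventIntegrand r q l g y := by
      rw [intervalIntegral.integral_of_le hαx, intervalIntegral.integral_of_le hαx]
      exact integral_congr_ae (ae_restrict_of_ae_Ioi (fun z hz => hα.trans hz.1) hDderiv)
    have h3 : G x - G α = ∫ y in α..x, resolventIntegrand r q l g y :=
      intervalIntegral.integral_interval_sub_left
        ((intervalIntegrable_iff_integrableOn_Ioc_of_le hx.le).2 (hGi x hx))
        ((intervalIntegrable_iff_integrableOn_Ioc_of_le hα.le).2 (hGi α hα))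
    linarith
  set c := D x - G x with hc
  have hlim : Tendsto D (𝓝[>] 0) (𝓝 c) := by
    have h1 := (tendsto_integral_zero hGi).const_add c
    rw [add_zero] at h1
    refine h1.congr' ?_
    filter_upwards [Ioc_mem_nhdsGT hx] with α hα
    have := hconst α hα.1 hα.2
    simp only [hG] at this
    linarith
  -- The integrating factor is at most `M` on `(0, 1]`. If `1 / r` is integrable at `0`, the
  -- boundary condition gives `D → 0`. If not, `c ≠ 0` would imply `|c| / 2 < |D| ≤ M r |f|` near
  -- `0`, hence `1 / r ≤ (2 M / |c|) |f|`, which is integrable.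
  have hc0 : c = 0 := by
    set M := Real.exp (exponent r q l 1) with hM
    have hDM : ∀ y ∈ Ioc (0 : ℝ) 1, |D y| ≤ M * |φ y| := by
      intro y hy
      rw [hD]
      simp only
      rw [abs_mul, abs_of_nonneg (Real.exp_nonneg _)]
      refine mul_le_mul_of_nonneg_right (Real.exp_le_exp.2 ?_) (abs_nonneg _)
      exact H.monotoneOn_exponent hl hy.1 (mem_Ioi.2 one_pos) hy.2
    by_cases hr : InvIntegrableAtZero r
    · have h1 := (hφ.boundary hr).abs.const_mul M
      rw [abs_zero, mul_zero] at h1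
      refine tendsto_nhds_unique hlim (squeeze_zero_norm' ?_ h1)
      filter_upwards [Ioc_mem_nhdsGT (one_pos (α := ℝ))] with y hy using hDM y hy
    · by_contra hne
      have hcpos : 0 < |c| / 2 := by positivity
      have h1 : ∀ᶠ y in 𝓝[>] (0 : ℝ), |c| / 2 < |D y| :=
        hlim.abs.eventually (lt_mem_nhds (by linarith [abs_pos.2 hne]))
      obtain ⟨ε, hε, hε2⟩ := mem_nhdsGT_iff_exists_Ioo_subset.1 h1
      have hε0 : (0 : ℝ) < ε := hε
      refine hr ⟨min ε 1, by positivity, ?_⟩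
      have hsub : Ioo 0 (min ε 1) ⊆ Ioi (0 : ℝ) := Ioo_subset_Ioi_self
      have h2 : IntegrableOn (fun y => M / (|c| / 2) * |f y|) (Ioo 0 (min ε 1)) :=
        (((integrableOn_Ioi_of_memLp (Lp.memLp f)).mono_set hsub).abs).const_mul _
      refine h2.mono' (H.inv_loc.aestronglyMeasurable.mono_measure
        (Measure.restrict_mono hsub le_rfl)) ?_
      filter_upwards [ae_restrict_mem measurableSet_Ioo, ae_restrict_of_ae_Ioi hsub H.pos,
        ae_restrict_of_ae_Ioi hsub hφ.rep] with y hy1 hy2 hy3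
      have h3 : |c| / 2 < |D y| := hε2 ⟨hy1.1, hy1.2.trans_le (min_le_left _ _)⟩
      have h4 := hDM y ⟨hy1.1, hy1.2.le.trans (min_le_right _ _)⟩
      rw [hy3, abs_mul (r y), abs_of_pos hy2] at h4
      rw [Real.norm_of_nonneg (by positivity), div_le_iff₀ hy2, div_mul_eq_mul_div,
        div_mul_eq_mul_div, le_div_iff₀ hcpos]
      nlinarith
  have h1 : D x = G x := sub_eq_zero.1 hc0
  have h2 : flux r q l g x = Real.exp (-exponent r q l x) * G x := rfl
  rw [h2, ← h1, hD]
  simp only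
  rw [← mul_assoc, ← Real.exp_add, neg_add_cancel, Real.exp_zero, one_mul]

theorem isResolvent (H : Admissible r q ρ) (hm : 1 ≤ m) (hl : 2 * m * ρ < l) :
    IsResolvent (transportOp r q m) l (H.resolvent hm hl) := by
  refine ⟨fun g => ⟨⟨flux r q l g, H.isDomainRep_resolvent hm hl g⟩, ?_⟩, ?_⟩
  · rw [transportOp_apply (H.isDomainRep_resolvent hm hl g), transportValue]
    ext
    refine ae_weightMeasure_of_ae_Ioi ?_
    have h1 := ae_Ioi_of_ae_weightMeasure (MemLp.coeFn_toLp
      ((H.isDomainRep_resolvent hm hl g).deriv_mem.neg.sub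
        (H.isDomainRep_resolvent hm hl g).absorption_mem))
    filter_upwards [h1, ae_Ioi_of_ae_weightMeasure (Lp.coeFn_sub (l • H.resolvent hm hl g) _),
      ae_Ioi_of_ae_weightMeasure (Lp.coeFn_smul l (H.resolvent hm hl g)),
      H.resolvent_ae_eq hm hl g, H.ae_hasDerivAt_flux (H.nonneg_of_lt hm hl)
      (integrableOn_Ioi_of_memLp (Lp.memLp g))] with x h1 h2 h3 h4 h5
    rw [h2, Pi.sub_apply, h3, Pi.smul_apply]
    erw [h1]
    simp only [Pi.sub_apply, Pi.neg_apply, smul_eq_mul, h5.deriv, h4]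
    ring
  · rintro ⟨f, φ, hφ⟩
    rw [transportOp_apply hφ]
    simp only
    set g : X m := l • f - transportValue hφ with hg
    have hgf : ∀ᵐ x ∂(volume.restrict (Ioi (0 : ℝ))), g x = l * f x + deriv φ x + q x * f x := by
      have h1 := ae_Ioi_of_ae_weightMeasure
        (MemLp.coeFn_toLp (hφ.deriv_mem.neg.sub hφ.absorption_mem))
      filter_upwards [h1, ae_Ioi_of_ae_weightMeasure (Lp.coeFn_sub (l • f) (transportValue hφ)),
        ae_Ioi_of_ae_weightMeasure (Lp.coeFn_smul l f)] with x h1 h2 h3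
      rw [hg, h2, Pi.sub_apply, h3, Pi.smul_apply, transportValue]
      erw [h1]
      simp only [Pi.sub_apply, Pi.neg_apply, smul_eq_mul]
      ring
    ext
    refine ae_weightMeasure_of_ae_Ioi ?_
    filter_upwards [H.resolvent_ae_eq hm hl g, hφ.rep, H.pos, ae_restrict_mem measurableSet_Ioi]
      with x h1 h2 h3 h4
    rw [h1, resolventFormula_eq, H.flux_eq_of_isDomainRep (H.nonneg_of_lt hm hl) hφ
      (integrableOn_Ioi_of_memLp (Lp.memLp g)) hgf h4, h2]
    field_simp

end Admissible

/-! ### Density of the domain. -/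

theorem isLocallyFiniteMeasure_weightMeasure {m : ℝ} (hm : 0 ≤ m) :
    IsLocallyFiniteMeasure (weightMeasure m) := by
  exact IsLocallyFiniteMeasure.withDensity_ofReal
    (continuous_const.add (Real.continuous_rpow_const hm))

theorem MemLinftyLoc.exists_bound {q : ℝ → ℝ} (hq : MemLinftyLoc q) (N : ℝ) :
    ∃ C : ℝ, 0 ≤ C ∧ ∀ᵐ x ∂(volume.restrict (Ioc 0 N)), |q x| ≤ C := by
  refine ⟨(eLpNorm q ⊤ (volume.restrict (Ioc 0 N))).toReal, ENNReal.toReal_nonneg, ?_⟩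
  filter_upwards [ae_le_eLpNormEssSup (f := q) (μ := volume.restrict (Ioc 0 N))] with x hx
  rw [← eLpNorm_exponent_top] at hx
  have := ENNReal.toReal_mono (hq N).2.ne hx
  simpa using this

namespace Admissible

variable {r q : ℝ → ℝ} {ρ m : ℝ}

theorem aemeasurable_inv_weightMeasure (H : Admissible r q ρ) :
    AEMeasurable (fun x => ENNReal.ofReal (1 / r x)) (weightMeasure m) :=
  (aestronglyMeasurable_weightMeasure_iff.2
    H.inv_loc.aestronglyMeasurable).aemeasurable.ennreal_ofReal

theorem lintegral_inv_ne_top (H : Admissible r q ρ) (hm : 0 ≤ m) {K : Set ℝ} (hK : IsCompact K)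
    (hK0 : K ⊆ Ioi 0) : ∫⁻ x in K, ENNReal.ofReal (1 / r x) ∂(weightMeasure m) ≠ ⊤ := by
  have h1 : IntegrableOn (fun x => 1 / r x) K :=
    H.inv_loc.integrableOn_compact_subset hK0 hK
  have h2 : IntegrableOn (fun x => 1 / r x * (1 + x ^ m)) K :=
    h1.mul_continuousOn (continuous_const.add (Real.continuous_rpow_const hm)).continuousOn hK
  have h3 := h2.2
  rw [hasFiniteIntegral_iff_enorm] at h3
  refine ne_top_of_le_ne_top h3.ne ?_
  rw [weightMeasure, restrict_withDensity hK.measurableSet, Measure.restrict_restrict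
    hK.measurableSet, inter_eq_left.2 hK0,
    lintegral_withDensity_eq_lintegral_mul_non_measurable _ (by fun_prop)
      (Eventually.of_forall fun _ => ENNReal.ofReal_lt_top)]
  refine setLIntegral_mono' hK.measurableSet fun x hx => ?_
  rw [Pi.mul_apply, enorm_mul, mul_comm]
  exact mul_le_mul' (Real.ofReal_le_enorm _) (Real.ofReal_le_enorm _)

/-- Division by `r` of a `C¹` function with compact support in `(0, ∞)` gives a function of the
domain. -/
theorem mem_transportDomain (H : Admissible r q ρ) (hm : 0 ≤ m) {φ : ℝ → ℝ} (hφ : ContDiff ℝ 1 φ)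
    (hφc : HasCompactSupport φ) {α β : ℝ} (hα : 0 < α) (hφ0 : ∀ x, x ∉ Icc α β → φ x = 0)
    (hmem : MemLp (fun x => φ x / r x) 1 (weightMeasure m)) :
    hmem.toLp _ ∈ transportDomain r q m := by
  have := isLocallyFiniteMeasure_weightMeasure hm
  have hcoe := ae_Ioi_of_ae_weightMeasure hmem.coeFn_toLp
  refine ⟨φ, ?_, isLocAC_of_contDiffOn hφ.contDiffOn, ?_, ?_, fun _ => ?_⟩
  · filter_upwards [hcoe, H.pos] with x h1 h2
    rw [h1]
    field_simp
  · exact (hφ.continuous_deriv le_rfl).memLp_of_hasCompactSupport hφc.deriv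
  · obtain ⟨C, hC0, hC⟩ := H.loc.exists_bound β
    rw [ae_restrict_iff' measurableSet_Ioc] at hC
    refine (hmem.const_mul C).mono ?_ ?_
    · exact (aestronglyMeasurable_weightMeasure_iff.2 H.aemeasurable_q).mul
        (Lp.aestronglyMeasurable _)
    · refine ae_weightMeasure_of_ae_Ioi ?_
      filter_upwards [hcoe, ae_restrict_of_ae hC] with x h1 h2
      rw [h1, norm_mul, norm_mul, Real.norm_of_nonneg hC0]
      by_cases hx : x ∈ Icc α β
      · exact mul_le_mul_of_nonneg_right (h2 ⟨hα.trans_le hx.1, hx.2⟩) (norm_nonneg _)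
      · simp [hφ0 x hx]
  · refine tendsto_const_nhds.congr' ?_
    filter_upwards [Ioo_mem_nhdsGT hα] with x hx
    exact (hφ0 x fun h => not_lt.2 h.1 hx.2).symm

/-- Smoothing `f` itself is useless, as its product with a merely measurable `r` need not be
absolutely continuous. Instead `F = r f` on `[α, β]` is approximated in `L¹` of `w / r dx`, with `w`
the weight, and the approximant is divided by `r`; the factor `1 / r` in the measure turns the error
into the norm of `X m`. -/
theorem exists_mem_transportDomain_of_indicator (H : Admissible r q ρ) (hm : 0 ≤ m) (f : X m)
    {α β : ℝ} (hα : 0 < α) (hαβ : α < β) {ε : ℝ} (hε : 0 < ε) :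
    ∃ h ∈ transportDomain r q m,
      ∫⁻ x, ‖(Icc α β).indicator f x - h x‖ₑ ∂(weightMeasure m) ≤ ENNReal.ofReal ε := by
  set α' := α / 2 with hα'
  set β' := β + α / 2 with hβ'
  have hα'0 : 0 < α' := by positivity
  -- The outer radius exceeds the inner one by `α / 2`, so the support lies in `[α / 2, β + α / 2]`,
  -- away from `0`.
  let χ : ContDiffBump ((α + β) / 2) := ⟨(β - α) / 2, (β - α) / 2 + α / 2, by linarith, by linarith⟩
  have hχ1 : ∀ x ∈ Icc α β, χ x = 1 := by
    intro x hx
    refine χ.one_of_mem_closedBall ?_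
    rw [Real.closedBall_eq_Icc]
    exact ⟨by simp only [χ]; linarith [hx.1], by simp only [χ]; linarith [hx.2]⟩
  have hχ0 : ∀ x, x ∉ Icc α' β' → χ x = 0 := by
    intro x hx
    refine χ.zero_of_le_dist ?_
    by_contra hlt
    rw [not_le, Real.dist_eq, abs_lt] at hlt
    exact hx ⟨by simp only [χ] at hlt; linarith [hlt.1], by simp only [χ] at hlt; linarith [hlt.2]⟩
  set K := Icc α' β' with hK
  have hK0 : K ⊆ Ioi 0 := fun x hx => hα'0.trans_le hx.1
  set μ := ((weightMeasure m).restrict K).withDensity fun x => ENNReal.ofReal (1 / r x) with hμ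
  have hμfin : IsFiniteMeasure μ :=
    isFiniteMeasure_withDensity (H.lintegral_inv_ne_top hm isCompact_Icc hK0)
  have hμint : ∀ F : ℝ → ℝ≥0∞, ∫⁻ x, F x ∂μ =
      ∫⁻ x in K, ENNReal.ofReal (1 / r x) * F x ∂(weightMeasure m) := fun F =>
    lintegral_withDensity_eq_lintegral_mul_non_measurable₀ _
      H.aemeasurable_inv_weightMeasure.restrict
      (Eventually.of_forall fun _ => ENNReal.ofReal_lt_top) F
  have hrpos : ∀ᵐ x ∂(weightMeasure m), 0 < r x := ae_weightMeasure_of_ae_Ioi H.pos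
  have hrmeas : AEStronglyMeasurable r (weightMeasure m) :=
    aestronglyMeasurable_weightMeasure_iff.2 H.aemeasurable_r
  set F : ℝ → ℝ := fun x => r x * (Icc α β).indicator f x with hF
  have hFmem : MemLp F 1 μ := by
    refine ⟨?_, ?_⟩
    · have h1 : AEStronglyMeasurable F (weightMeasure m) :=
        hrmeas.mul ((Lp.aestronglyMeasurable f).indicator measurableSet_Icc)
      exact h1.restrict.mono_ac (withDensity_absolutelyContinuous _ _)
    · rw [eLpNorm_one_eq_lintegral_enorm, hμint]
      have h1 : ∫⁻ x, ‖f x‖ₑ ∂(weightMeasure m) < ⊤ := by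
        rw [← eLpNorm_one_eq_lintegral_enorm]; exact (Lp.memLp f).2
      refine lt_of_le_of_lt (lintegral_mono_ae ?_)
        (lt_of_le_of_lt (setLIntegral_le_lintegral K _) h1)
      filter_upwards [ae_restrict_of_ae hrpos] with x hx
      rw [← Real.enorm_of_nonneg (by positivity), ← enorm_mul, hF]
      simp only
      rw [← mul_assoc, one_div, inv_mul_cancel₀ hx.ne', one_mul]
      exact enorm_indicator_le_enorm_self _ _
  obtain ⟨h, hhc, hhd, hh⟩ := hFmem.exist_eLpNorm_sub_le ENNReal.one_ne_top le_rfl hε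
  set φ : ℝ → ℝ := fun x => χ x * h x with hφ
  have hφd : ContDiff ℝ 1 φ := χ.contDiff.mul (hhd.of_le (by exact_mod_cast le_top))
  have hφc : HasCompactSupport φ := hhc.mul_left
  have hφ0 : ∀ x, x ∉ K → φ x = 0 := fun x hx => by simp [hφ, hχ0 x hx]
  have hest : ∫⁻ x, ‖(Icc α β).indicator f x - φ x / r x‖ₑ ∂(weightMeasure m) ≤
      ENNReal.ofReal ε := by
    refine le_trans ?_ hh
    rw [eLpNorm_one_eq_lintegral_enorm, hμint, ← lintegral_indicator measurableSet_Icc]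
    refine lintegral_mono_ae ?_
    filter_upwards [hrpos] with x hx
    by_cases hxK : x ∈ K
    · rw [indicator_of_mem hxK, ← Real.enorm_of_nonneg (by positivity), ← enorm_mul]
      refine enorm_le_iff_norm_le.2 ?_
      have h1 : (Icc α β).indicator f x - φ x / r x = 1 / r x * (F x - φ x) := by
        rw [hF]; field_simp
      rw [h1, norm_mul, norm_mul]
      refine mul_le_mul_of_nonneg_left ?_ (norm_nonneg _)
      -- The cutoff does not increase the error: `χ = 1` on `[α, β]`, while outside `F = 0` and `χ ≤
      -- 1`.
      by_cases hx2 : x ∈ Icc α β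
      · rw [hφ, Pi.sub_apply]
        simp only
        rw [hχ1 x hx2, one_mul]
      · have h2 : F x = 0 := by rw [hF]; simp only; rw [indicator_of_notMem hx2, mul_zero]
        rw [Pi.sub_apply, h2, zero_sub, zero_sub, norm_neg, norm_neg, hφ]
        simp only
        rw [norm_mul, Real.norm_of_nonneg χ.nonneg]
        exact mul_le_of_le_one_left (norm_nonneg _) χ.le_one
    · have h1 : x ∉ Icc α β := fun hx2 => hxK ⟨by linarith [hx2.1], by linarith [hx2.2]⟩
      rw [indicator_of_notMem h1, hφ0 x hxK]
      simp
  have hmem : MemLp (fun x => φ x / r x) 1 (weightMeasure m) := by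
    have hm1 : AEStronglyMeasurable (fun x => φ x / r x) (weightMeasure m) :=
      (hφd.continuous.aestronglyMeasurable.aemeasurable.div
        hrmeas.aemeasurable).aestronglyMeasurable
    have hi : MemLp ((Icc α β).indicator f) 1 (weightMeasure m) :=
      (Lp.memLp f).indicator measurableSet_Icc
    have h2 : MemLp (fun x => (Icc α β).indicator f x - φ x / r x) 1 (weightMeasure m) := by
      refine ⟨hi.1.sub hm1, ?_⟩
      rw [eLpNorm_one_eq_lintegral_enorm]
      exact hest.trans_lt ENNReal.ofReal_lt_top
    refine (memLp_congr_ae (Eventually.of_forall fun x => ?_)).2 (hi.sub h2)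
    simp
  refine ⟨hmem.toLp _, H.mem_transportDomain hm hφd hφc hα'0 hφ0 hmem, ?_⟩
  refine le_of_eq_of_le (lintegral_congr_ae ?_) hest
  filter_upwards [hmem.coeFn_toLp] with x hx
  rw [hx]

theorem dense_transportDomain (H : Admissible r q ρ) (hm : 0 ≤ m) :
    Dense (transportDomain r q m : Set (X m)) := by
  intro f
  rw [Metric.mem_closure_iff]
  intro ε hε
  set a : ℕ → ℝ := fun n => 1 / ((n : ℝ) + 1) with ha
  -- With `n + 2` the inequality `a n < b n` is strict also at `n = 0`, as the bump function
  -- requires.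
  set b : ℕ → ℝ := fun n => (n : ℝ) + 2 with hb
  have ha0 : ∀ n, 0 < a n := fun n => by positivity
  have hab : ∀ n, a n < b n := fun n => by
    have hn : (0 : ℝ) < (n : ℝ) + 1 := by positivity
    simp only [ha, hb]
    rw [div_lt_iff₀ hn]
    nlinarith [(Nat.cast_nonneg n : (0 : ℝ) ≤ n)]
  have hcov : ∀ᵐ x ∂(weightMeasure m), ∀ᶠ n in atTop, x ∈ Icc (a n) (b n) := by
    refine ae_weightMeasure_of_ae_Ioi ?_
    filter_upwards [ae_restrict_mem measurableSet_Ioi] with x hx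
    have h1 : ∀ᶠ n in atTop, a n < x :=
      tendsto_one_div_add_atTop_nhds_zero_nat.eventually (gt_mem_nhds hx)
    have h2 : ∀ᶠ n in atTop, x ≤ b n :=
      (tendsto_atTop_add_const_right _ _ tendsto_natCast_atTop_atTop).eventually_ge_atTop x
    filter_upwards [h1, h2] with n h3 h4 using ⟨h3.le, h4⟩
  have hlim : Tendsto (fun n => ∫⁻ x, ‖f x - (Icc (a n) (b n)).indicator f x‖ₑ ∂(weightMeasure m))
      atTop (𝓝 (∫⁻ _, 0 ∂(weightMeasure m))) := by
    refine tendsto_lintegral_of_dominated_convergence' (fun x => ‖f x‖ₑ) ?_ ?_ ?_ ?_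
    · exact fun n => ((Lp.aestronglyMeasurable f).sub
        ((Lp.aestronglyMeasurable f).indicator measurableSet_Icc)).enorm
    · intro n
      refine Eventually.of_forall fun x => ?_
      by_cases hx : x ∈ Icc (a n) (b n)
      · simp [indicator_of_mem hx]
      · simp [indicator_of_notMem hx]
    · rw [← eLpNorm_one_eq_lintegral_enorm]
      exact (Lp.memLp f).2.ne
    · filter_upwards [hcov] with x hx
      refine tendsto_const_nhds.congr' ?_
      filter_upwards [hx] with n hn
      simp [indicator_of_mem hn]
  rw [lintegral_zero] at hlim
  obtain ⟨n, hn⟩ := (hlim.eventually (gt_mem_nhds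
    (show (0 : ℝ≥0∞) < ENNReal.ofReal (ε / 2) by simpa using hε))).exists
  obtain ⟨h, hh, hle⟩ := H.exists_mem_transportDomain_of_indicator hm f (ha0 n) (hab n)
    (ε := ε / 4) (by positivity)
  refine ⟨h, hh, ?_⟩
  have hsum : ∫⁻ x, ‖f x - h x‖ₑ ∂(weightMeasure m) < ENNReal.ofReal ε := by
    calc ∫⁻ x, ‖f x - h x‖ₑ ∂(weightMeasure m)
        ≤ ∫⁻ x, (‖f x - (Icc (a n) (b n)).indicator f x‖ₑ +
            ‖(Icc (a n) (b n)).indicator f x - h x‖ₑ) ∂(weightMeasure m) := by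
          refine lintegral_mono fun x => ?_
          have : f x - h x = (f x - (Icc (a n) (b n)).indicator f x) +
            ((Icc (a n) (b n)).indicator f x - h x) := by ring
          rw [this]
          exact enorm_add_le _ _
      _ = ∫⁻ x, ‖f x - (Icc (a n) (b n)).indicator f x‖ₑ ∂(weightMeasure m) +
            ∫⁻ x, ‖(Icc (a n) (b n)).indicator f x - h x‖ₑ ∂(weightMeasure m) :=
          lintegral_add_left' ((Lp.aestronglyMeasurable f).sub
            ((Lp.aestronglyMeasurable f).indicator measurableSet_Icc)).enorm _
      _ < ENNReal.ofReal (ε / 2) + ENNReal.ofReal (ε / 2) :=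
          ENNReal.add_lt_add hn (hle.trans_lt
            ((ENNReal.ofReal_lt_ofReal_iff (by positivity)).2 (by linarith)))
      _ = ENNReal.ofReal ε := by
          rw [← ENNReal.ofReal_add (by positivity) (by positivity), add_halves]
  rw [Lp.dist_def, eLpNorm_one_eq_lintegral_enorm]
  refine (ENNReal.lt_ofReal_iff_toReal_lt ?_).1 hsum
  exact (hsum.trans ENNReal.ofReal_lt_top).ne

end Admissible

end GrowthTransport

/-! ### Resolvent and semigroup for the given coefficients. -/

theorem mainTheorem1
    (a a₁ r : ℝ → ℝ) (r₀ r₁ : ℝ)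
    (ha_nonneg : ∀ᵐ x ∂(volume.restrict (Ioi (0 : ℝ))), 0 ≤ a x)
    (ha_loc : GrowthTransport.MemLinftyLoc a)
    (hr₀ : 0 ≤ r₀) (hr₁ : 0 ≤ r₁)
    (hr_loc : LocallyIntegrableOn (fun x => 1 / r x) (Ioi (0 : ℝ)))
    (hr_bound : ∀ᵐ x ∂(volume.restrict (Ioi (0 : ℝ))), 0 < r x ∧ r x ≤ r₀ + r₁ * x)
    (ha₁_nonneg : ∀ᵐ x ∂(volume.restrict (Ioi (0 : ℝ))), 0 ≤ a₁ x)
    (ha₁_loc : GrowthTransport.MemLinftyLoc a₁)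
    (ha₁_bound : ∃ C N : ℝ, ∀ᵐ x ∂(volume.restrict (Ioi (0 : ℝ))), N ≤ x → a₁ x ≤ C * a x)
    (m : ℝ) (hm : 1 ≤ m) :
    (∀ l : ℝ, 2 * m * max r₀ r₁ < l →
      ∃ J : GrowthTransport.X m →L[ℝ] GrowthTransport.X m,
        GrowthTransport.IsResolvent (GrowthTransport.transportOp r (a + a₁) m) l J ∧
        (∀ g : GrowthTransport.X m,
          (∀ x : ℝ, 0 < x →
            IntegrableOn (GrowthTransport.resolventIntegrand r (a + a₁) l g) (Ioc 0 x)) ∧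
          ∀ᵐ x ∂(volume.restrict (Ioi (0 : ℝ))),
            J g x = GrowthTransport.resolventFormula r (a + a₁) l g x) ∧
        ∀ g : GrowthTransport.X m, ‖J g‖ ≤ 1 / (l - 2 * m * max r₀ r₁) * ‖g‖) ∧
    ∃ S : ℝ → GrowthTransport.X m →L[ℝ] GrowthTransport.X m,
      GrowthTransport.IsC0Semigroup S ∧
      GrowthTransport.IsGeneratorOf (GrowthTransport.transportOp r (a + a₁) m) S ∧
      (∀ t : ℝ, 0 ≤ t → ∀ f : GrowthTransport.X m, 0 ≤ f → 0 ≤ S t f) ∧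
      ∀ t : ℝ, 0 ≤ t → ∀ f : GrowthTransport.X m,
        ‖S t f‖ ≤ Real.exp (2 * m * max r₀ r₁ * t) * ‖f‖ := by
  set ρ := max r₀ r₁ with hρ
  have hρ0 : 0 ≤ ρ := hr₀.trans (le_max_left _ _)
  have H : GrowthTransport.Admissible r (a + a₁) ρ :=
    { inv_loc := hr_loc
      pos := hr_bound.mono fun x hx => hx.1
      le := by
        filter_upwards [hr_bound, ae_restrict_mem measurableSet_Ioi] with x hx hx0
        have h1 : r₁ * x ≤ ρ * x :=
          mul_le_mul_of_nonneg_right (le_max_right _ _) (le_of_lt hx0)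
        have h2 : r₀ ≤ ρ := le_max_left _ _
        linarith [hx.2]
      nonneg := by
        filter_upwards [ha_nonneg, ha₁_nonneg] with x h1 h2 using add_nonneg h1 h2
      loc := fun N => (ha_loc N).add (ha₁_loc N) }
  refine ⟨fun l hl => ⟨H.resolvent hm hl, H.isResolvent hm hl, fun g => ⟨fun x hx => ?_,
    H.resolvent_ae_eq hm hl g⟩, H.norm_resolvent_le hm hl⟩, ?_⟩
  · exact H.integrableOn_resolventIntegrand (H.nonneg_of_lt hm hl)
      (GrowthTransport.integrableOn_Ioi_of_memLp (Lp.memLp g)) hx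
  -- The family is extended by `0` below the threshold so that it is indexed by all reals.
  · set J : ℝ → GrowthTransport.X m →L[ℝ] GrowthTransport.X m := fun l =>
      if hl : 2 * m * ρ < l then H.resolvent hm hl else 0 with hJ
    have hJeq : ∀ l (hl : 2 * m * ρ < l), J l = H.resolvent hm hl := fun l hl => dif_pos hl
    obtain ⟨S, h1, h2, h3, h4⟩ := GrowthTransport.hilleYosida
      (H.dense_transportDomain (m := m) (by linarith))
      (T := GrowthTransport.transportOp r (a + a₁) m)
      (w := 2 * m * ρ) (by positivity) (J := J)
      (fun l hl => by rw [hJeq l hl]; exact H.isResolvent hm hl)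
      (fun l hl g => by rw [hJeq l hl]; exact H.norm_resolvent_le hm hl g)
    refine ⟨S, h1, h2, fun t ht f hf => ?_, h3⟩
    -- Positivity of the semigroup is invariance of the closed cone of nonnegative functions.
    exact h4 (Ici 0) isClosed_Ici self_mem_Ici
      (fun f hf g hg => mem_Ici.2 (add_nonneg (mem_Ici.1 hf) (mem_Ici.1 hg)))
      (fun c hc f hf => by
        rw [mem_Ici, ← Lp.coeFn_nonneg] at hf ⊢
        filter_upwards [hf, Lp.coeFn_smul c f] with x hx hx2
        rw [hx2]
        exact mul_nonneg hc hx)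
      (fun l hl f hf => by rw [hJeq l hl]; exact mem_Ici.2 (H.resolvent_nonneg hm hl hf)) t ht hf
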